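/- Let $n\ge 0$ be an integer, $T>0$, $\Omega=\mathbb R^n/\mathbb Z^n$ the flat torus, $I=[0,T]$, $\Omega_I=\Omega\times I$. An orbit is a measure $\mu=\mu_{(t)}\,dt$ on $\Omega_I$, with $t\mapsto\mu_{(t)}$ a measurable family of Borel probability measures on $\Omega$. Let $C^1_0(\Omega_I)$ be the set of functions $\phi(x,t)$ of class $C^1$ on $\Omega_I$ with $\phi(\cdot,0)=\phi(\cdot,T)=0$. A lifting of an orbit $\mu$ is a Borel measure $\nu$ on $\Omega_I\times\mathbb R^n$ with marginal $\mu$ on $\Omega_I$ such that, for every $\psi\in C^1_0(\Omega_I)$, the function $\psi_t+v\cdot\nabla_x\psi$ is $\nu$-integrable and $\int(\psi_t+v\cdot\nabla_x\psi)\,\nu(dx\,dt\,dv)=0$. Let ${\bf H}_2$ be the set of orbits $\mu$ having a lifting $\nu$ with $\int|v|^2\,d\nu<\infty$, and for such $\mu$ let $\|\mu\|_2=\inf_\nu\left(\int|v|^2\,d\nu\right)^{1/2}$, the infimum being over all liftings $\nu$ of $\mu$. For Borel probability measures $\mu_0,\mu_1$ on $\Omega$, let $\Lambda_2(\mu_0,\mu_1)$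 be the set of $\mu\in{\bf H}_2$ that can be written $\mu=\mu_{(t)}\,dt$ with $t\mapsto\mu_{(t)}$ weakly continuous on $[0,T]$, $\mu_{(0)}=\mu_0$ and $\mu_{(T)}=\mu_1$. Then for every $\mu\in{\bf H}_2$ $$\frac12\|\mu\|_2^2=-\inf_{\phi\in C^1_0(\Omega_I)}\int_{\Omega_I}\Big(\phi_t+\frac{|\nabla_x\phi|^2}{2}\Big)\,d\mu=\frac12\sup_{\phi\in C^1_0(\Omega_I)}\frac{\left(\int_{\Omega_I}\phi_t\,d\mu\right)^2}{\int_{\Omega_I}|\nabla_x\phi|^2\,d\mu},$$ where the quotient is taken in $[0,\infty]$ with $0/0=0$ and $a/0=\infty$ for $a>0$. Moreover, for every $\mu\in{\bf H}_2$ and all Borel probability measures $\mu_0,\mu_1$ on $\Omega$, $$-\inf_{\phi}\left\{\int_{\Omega_I}\Big(\phi_t+\frac{|\nabla_x\phi|^2}{2}\Big)\,d\mu+\int_\Omega\phi(x,0)\,\mu_0(dx)-\int_\Omega\phi(x,T)\,\mu_1(dx)\right\}=\begin{cases}\frac12\|\mu\|_2^2&\text{if }\mu\in\Lambda_2(\mu_0,\mu_1),\\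 +\infty&\text{if }\mu\notin\Lambda_2(\mu_0,\mu_1),\end{cases}$$ where the infimum is over all $\phi$ that are Lipschitz on $\Omega\times[0,T]$ and of class $C^1$ on $\Omega\times(0,T)$. -/

import Mathlib

open MeasureTheory ProbabilityTheory Set
open scoped ENNReal

noncomputable section

namespace MeasureOrbit

/-- The Euclidean space `ℝⁿ` (velocities, and the universal cover of the torus). -/
abbrev Vel (n : ℕ) : Type := EuclideanSpace ℝ (Fin n)

/-- The flat torus `Ω = ℝⁿ / ℤⁿ`. -/
abbrev Torus (n : ℕ) : Type := UnitAddTorus (Fin n)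

/-- The covering map `ℝⁿ → ℝⁿ / ℤⁿ`. -/
def proj {n : ℕ} (y : Vel n) : Torus n := fun i => (y i : UnitAddCircle)

/-- The periodic lift to `ℝ × ℝⁿ` of a function `φ(t, x)` of time and of a point of the torus. -/
def lift {n : ℕ} (φ : ℝ → Torus n → ℝ) : ℝ × Vel n → ℝ := fun q => φ q.1 (proj q.2)

/-- The time derivative `φ_t (t, x)`. For the functions below it is the classical derivative when
`0 < t < T`; the slices `t = 0` and `t = T` are null sets of all measures it is integrated against. -/
def timeDeriv {n : ℕ} (φ : ℝ → Torus n → ℝ) (t : ℝ) (x : Torus n) : ℝ :=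
  deriv (fun s => φ s x) t

/-- The spatial gradient `∇ₓ φ (t, x)`, computed in the flat chart `y ↦ x + proj y` around `x`. -/
def spaceGrad {n : ℕ} (φ : ℝ → Torus n → ℝ) (t : ℝ) (x : Torus n) : Vel n :=
  gradient (fun y : Vel n => φ t (x + proj y)) 0

/-- `C¹₀(Ω × [0,T])`: functions of class `C¹` on `Ω × [0,T]` (up to the end times) which vanish at
`t = 0` and at `t = T`. -/
def C10 (n : ℕ) (T : ℝ) : Set (ℝ → Torus n → ℝ) :=
  {φ | ContDiffOn ℝ 1 (lift φ) (Icc 0 T ×ˢ univ) ∧ (∀ x, φ 0 x = 0) ∧ ∀ x, φ T x = 0}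

/-- `C¹(Ω × (0,T)) ∩ LIP(Ω × [0,T])`. -/
def C1Lip (n : ℕ) (T : ℝ) : Set (ℝ → Torus n → ℝ) :=
  {φ | ContDiffOn ℝ 1 (lift φ) (Ioo 0 T ×ˢ univ) ∧
    ∃ K : NNReal, LipschitzOnWith K (lift φ) (Icc 0 T ×ˢ univ)}

/-- `μ = μ_(t) dt` on `[0,T] × Ω`, where `μ_(t) = κ t` is a probability measure for each `t`. -/
def Decomposes {n : ℕ} (T : ℝ) (μ : Measure (ℝ × Torus n)) (κ : Kernel ℝ (Torus n)) : Prop :=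
  IsMarkovKernel κ ∧ μ = (volume.restrict (Icc 0 T)).compProd κ

/-- The orbits: measures on `[0,T] × Ω` of the form `μ_(t) dt`, `μ_(t)` probability measures. -/
def Orbits (n : ℕ) (T : ℝ) : Set (Measure (ℝ × Torus n)) :=
  {μ | ∃ κ : Kernel ℝ (Torus n), Decomposes T μ κ}

/-- `ν(dt dx dv)` is a lifting of `μ(dt dx)`: its marginal is `μ`, and it solves the weak
continuity equation `∫ (ψ_t + v · ∇ₓ ψ) dν = 0` for all `ψ ∈ C¹₀(Ω × [0,T])`. -/
def IsLifting {n : ℕ} (T : ℝ) (μ : Measure (ℝ × Torus n))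
    (ν : Measure ((ℝ × Torus n) × Vel n)) : Prop :=
  ν.map Prod.fst = μ ∧
  ∀ ψ ∈ C10 n T,
    Integrable (fun q : (ℝ × Torus n) × Vel n =>
      timeDeriv ψ q.1.1 q.1.2 + inner ℝ q.2 (spaceGrad ψ q.1.1 q.1.2)) ν ∧
    ∫ q, (timeDeriv ψ q.1.1 q.1.2 + inner ℝ q.2 (spaceGrad ψ q.1.1 q.1.2)) ∂ν = 0

/-- The set `H_p` of the orbits that have a lifting with finite `p`-th velocity moment. -/
def H (n : ℕ) (T p : ℝ) : Set (Measure (ℝ × Torus n)) :=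
  {μ | μ ∈ Orbits n T ∧ ∃ ν, IsLifting T μ ν ∧ ∫⁻ q, ‖q.2‖ₑ ^ p ∂ν < ∞}

/-- `‖μ‖_p`, the infimum over all liftings `ν` of `(∫ |v|^p dν)^(1/p)`. -/
def hNorm {n : ℕ} (T p : ℝ) (μ : Measure (ℝ × Torus n)) : ℝ≥0∞ :=
  ⨅ (ν : Measure ((ℝ × Torus n) × Vel n)) (_ : IsLifting T μ ν), (∫⁻ q, ‖q.2‖ₑ ^ p ∂ν) ^ (1 / p)

/-- `Λ_p(μ₀, μ₁)`: the `μ = μ_(t) dt` in `H_p` with `μ_(0) = μ₀` and `μ_(T) = μ₁`, where `μ_(t)` is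
the weakly continuous version of the decomposition. -/
def Lam {n : ℕ} (T p : ℝ) (μ₀ μ₁ : Measure (Torus n)) : Set (Measure (ℝ × Torus n)) :=
  {μ | μ ∈ H n T p ∧ ∃ κ : Kernel ℝ (Torus n), Decomposes T μ κ ∧
    (∀ f : C(Torus n, ℝ), ContinuousOn (fun t => ∫ x, f x ∂(κ t)) (Icc 0 T)) ∧
    κ 0 = μ₀ ∧ κ T = μ₁}

/-- `∫ (φ_t + |∇ₓ φ|² / 2) dμ`. -/
def hjIntegral {n : ℕ} (μ : Measure (ℝ × Torus n)) (φ : ℝ → Torus n → ℝ) : ℝ :=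
  ∫ q, (timeDeriv φ q.1 q.2 + ‖spaceGrad φ q.1 q.2‖ ^ 2 / 2) ∂μ

/-- `(∫ φ_t dμ)² / ∫ |∇ₓ φ|² dμ` in `[0,∞]`, with `0 / 0 = 0` and `a / 0 = ∞` for `a > 0`. -/
def quotient {n : ℕ} (μ : Measure (ℝ × Torus n)) (φ : ℝ → Torus n → ℝ) : ℝ≥0∞ :=
  ENNReal.ofReal ((∫ q, timeDeriv φ q.1 q.2 ∂μ) ^ 2) /
    ENNReal.ofReal (∫ q, ‖spaceGrad φ q.1 q.2‖ ^ 2 ∂μ)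

/-- `∫ (φ_t + |∇ₓ φ|² / 2) dμ + ∫ φ(·,0) dμ₀ - ∫ φ(·,T) dμ₁`. -/
def hjBoundary {n : ℕ} (T : ℝ) (μ : Measure (ℝ × Torus n)) (μ₀ μ₁ : Measure (Torus n))
    (φ : ℝ → Torus n → ℝ) : ℝ :=
  hjIntegral μ φ + ∫ x, φ 0 x ∂μ₀ - ∫ x, φ T x ∂μ₁

end MeasureOrbit

end

/-! The upper bound is Young's inequality: for a lifting `ν` of finite energy, `v · ∇φ - |∇φ|²/2 ≤
|v|²/2`, and integrating gives `neg_transport_le`. For `φ ∈ C10` the transport term vanishes, so `s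
:= -inf ∫ (φ_t + |∇φ|²/2) dμ` is at most `‖μ‖₂²/2`. Replacing `φ` by `cφ` and optimizing in `c`
turns `s` into a bound `2s` on all quotients (`quotient_le_of_neg_hjIntegral_le`). A bound `Q` on
the quotients says that `φ ↦ -∫ φ_t dμ` is dominated by `√Q` times the `L²(μ)` norm of `∇φ`; Riesz
representation then gives a vector field `w` whose graph carries a lifting of energy at most `Q`
(`exists_lifting_of_quotient_le`). The chain `‖μ‖₂² ≤ sup quotient ≤ 2s ≤ ‖μ‖₂²` closes up.

For the boundary version, testing with `η(t) φ` and the du Bois-Reymond lemma shows that `∫ φ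
dμ_(t)` is a.e. a continuous primitive (`exists_timeMean_ae_eq`). With trigonometric monomials and
compactness of the probability measures on the torus this produces a weakly continuous version
(`exists_continuous_version`), and for such a version the transport term is the difference of the
end values (`integral_transport_eq`). If the end values are the prescribed ones, Young's inequality
applies as before. Otherwise test functions `c e(t)^N f(x)`, with `e^N` concentrating at one end
time, keep the boundary mismatch while their gradients become negligible, and the infimum is `-∞`.
-/

namespace MeasureOrbit

open Filter Topology

/-! ### Calculus on the torus through periodic lifts. -/

section

variable {n : ℕ} {T : ℝ}

lemma proj_add (y z : Vel n) : proj (y + z) = proj y + proj z := by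
  ext i; simp [proj]

lemma isOpenQuotientMap_proj : IsOpenQuotientMap (proj : Vel n → Torus n) := by
  have h : IsOpenQuotientMap (Pi.map fun (_ : Fin n) (r : ℝ) => (r : UnitAddCircle)) :=
    IsOpenQuotientMap.piMap fun _ => QuotientAddGroup.isOpenQuotientMap_mk
  exact h.comp (EuclideanSpace.equiv (Fin n) ℝ).toHomeomorph.isOpenQuotientMap

lemma isOpenQuotientMap_prodMap_proj :
    IsOpenQuotientMap (Prod.map id proj : ℝ × Vel n → ℝ × Torus n) :=
  IsOpenQuotientMap.id.prodMap isOpenQuotientMap_proj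

lemma differentiableAt_lift {φ : ℝ → Torus n → ℝ}
    (h : ContDiffOn ℝ 1 (lift φ) (Ioo 0 T ×ˢ univ)) {t : ℝ} (ht : t ∈ Ioo 0 T) (y : Vel n) :
    DifferentiableAt ℝ (lift φ) (t, y) :=
  (h.differentiableOn (by simp)).differentiableAt
    ((isOpen_Ioo.prod isOpen_univ).mem_nhds ⟨ht, mem_univ _⟩)

lemma hasDerivAt_of_lift {φ : ℝ → Torus n → ℝ} {t : ℝ} {y : Vel n}
    (h : DifferentiableAt ℝ (lift φ) (t, y)) :
    HasDerivAt (fun s => φ s (proj y)) (fderiv ℝ (lift φ) (t, y) (1, 0)) t := by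
  have h1 : HasDerivAt (fun s : ℝ => (s, y)) ((1 : ℝ), (0 : Vel n)) t :=
    (hasDerivAt_id t).prodMk (hasDerivAt_const t y)
  exact h.hasFDerivAt.comp_hasDerivAt t h1

lemma hasGradientAt_of_lift {φ : ℝ → Torus n → ℝ} {t : ℝ} {y : Vel n}
    (h : DifferentiableAt ℝ (lift φ) (t, y)) :
    HasGradientAt (fun z : Vel n => φ t (proj y + proj z))
      ((InnerProductSpace.toDual ℝ (Vel n)).symm
        ((fderiv ℝ (lift φ) (t, y)).comp (ContinuousLinearMap.inr ℝ ℝ (Vel n)))) 0 := by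
  rw [hasGradientAt_iff_hasFDerivAt, LinearIsometryEquiv.apply_symm_apply]
  have h1 : HasFDerivAt (fun z : Vel n => (t, y + z)) (ContinuousLinearMap.inr ℝ ℝ (Vel n)) 0 :=
    (hasFDerivAt_const t (0 : Vel n)).prodMk ((hasFDerivAt_id (0 : Vel n)).const_add y)
  have h2 : HasFDerivAt (lift φ) (fderiv ℝ (lift φ) (t, y)) (t, y + 0) := by
    simpa using h.hasFDerivAt
  have h3 := h2.comp (0 : Vel n) h1
  refine h3.congr_of_eventuallyEq (Eventually.of_forall fun z => ?_)
  simp [lift, proj_add]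

lemma hasDerivAt_timeDeriv {φ : ℝ → Torus n → ℝ}
    (h : ContDiffOn ℝ 1 (lift φ) (Ioo 0 T ×ˢ univ)) {t : ℝ} (ht : t ∈ Ioo 0 T) (x : Torus n) :
    HasDerivAt (fun s => φ s x) (timeDeriv φ t x) t := by
  obtain ⟨y, rfl⟩ := isOpenQuotientMap_proj.surjective x
  exact (hasDerivAt_of_lift (differentiableAt_lift h ht y)).differentiableAt.hasDerivAt

lemma hasGradientAt_spaceGrad {φ : ℝ → Torus n → ℝ}
    (h : ContDiffOn ℝ 1 (lift φ) (Ioo 0 T ×ˢ univ)) {t : ℝ} (ht : t ∈ Ioo 0 T) (x : Torus n) :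
    HasGradientAt (fun y : Vel n => φ t (x + proj y)) (spaceGrad φ t x) 0 := by
  obtain ⟨y, rfl⟩ := isOpenQuotientMap_proj.surjective x
  exact (hasGradientAt_of_lift (differentiableAt_lift h ht y)).differentiableAt.hasGradientAt

lemma timeDeriv_proj {φ : ℝ → Torus n → ℝ} {t : ℝ} {y : Vel n}
    (h : DifferentiableAt ℝ (lift φ) (t, y)) :
    timeDeriv φ t (proj y) = fderiv ℝ (lift φ) (t, y) (1, 0) :=
  (hasDerivAt_of_lift h).deriv

lemma spaceGrad_proj {φ : ℝ → Torus n → ℝ} {t : ℝ} {y : Vel n}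
    (h : DifferentiableAt ℝ (lift φ) (t, y)) :
    spaceGrad φ t (proj y) = (InnerProductSpace.toDual ℝ (Vel n)).symm
        ((fderiv ℝ (lift φ) (t, y)).comp (ContinuousLinearMap.inr ℝ ℝ (Vel n))) :=
  (hasGradientAt_of_lift h).gradient

/-- Because the covering map is open, and not merely a quotient map, continuity descends point by
point, hence on the slab of interior times alone. -/
lemma continuousOn_of_comp_proj {E : Type*} [TopologicalSpace E] {g : ℝ × Torus n → E}
    (hg : ContinuousOn (fun q : ℝ × Vel n => g (q.1, proj q.2)) (Ioo 0 T ×ˢ univ)) :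
    ContinuousOn g (Ioo 0 T ×ˢ univ) := by
  rintro ⟨t, x⟩ ⟨ht, -⟩
  obtain ⟨y, rfl⟩ := isOpenQuotientMap_proj.surjective x
  refine ContinuousAt.continuousWithinAt ?_
  refine (isOpenQuotientMap_prodMap_proj.continuousAt_comp_iff (x := (t, y))).1 ?_
  exact hg.continuousAt ((isOpen_Ioo.prod isOpen_univ).mem_nhds ⟨ht, mem_univ _⟩)

lemma continuousOn_timeDeriv {φ : ℝ → Torus n → ℝ}
    (h : ContDiffOn ℝ 1 (lift φ) (Ioo 0 T ×ˢ univ)) :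
    ContinuousOn (fun q : ℝ × Torus n => timeDeriv φ q.1 q.2) (Ioo 0 T ×ˢ univ) := by
  refine continuousOn_of_comp_proj ?_
  have hc := h.continuousOn_fderiv_of_isOpen (isOpen_Ioo.prod isOpen_univ) le_rfl
  refine (hc.clm_apply continuousOn_const (g := fun _ => ((1 : ℝ), (0 : Vel n)))).congr ?_
  rintro ⟨t, y⟩ ⟨ht, -⟩
  exact timeDeriv_proj (differentiableAt_lift h ht y)

lemma continuousOn_spaceGrad {φ : ℝ → Torus n → ℝ}
    (h : ContDiffOn ℝ 1 (lift φ) (Ioo 0 T ×ˢ univ)) :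
    ContinuousOn (fun q : ℝ × Torus n => spaceGrad φ q.1 q.2) (Ioo 0 T ×ˢ univ) := by
  refine continuousOn_of_comp_proj ?_
  have hc := h.continuousOn_fderiv_of_isOpen (isOpen_Ioo.prod isOpen_univ) le_rfl
  refine ((InnerProductSpace.toDual ℝ (Vel n)).symm.continuous.comp_continuousOn
    (hc.clm_comp (f := fun _ => ContinuousLinearMap.inr ℝ ℝ (Vel n)) continuousOn_const)).congr ?_
  rintro ⟨t, y⟩ ⟨ht, -⟩
  exact spaceGrad_proj (differentiableAt_lift h ht y)

lemma norm_fderiv_lift_le {φ : ℝ → Torus n → ℝ} {K : NNReal}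
    (h : LipschitzOnWith K (lift φ) (Icc 0 T ×ˢ univ)) {t : ℝ} (ht : t ∈ Ioo 0 T) (y : Vel n) :
    ‖fderiv ℝ (lift φ) (t, y)‖ ≤ K :=
  norm_fderiv_le_of_lipschitzOn ℝ
    (prod_mem_nhds (Icc_mem_nhds ht.1 ht.2) univ_mem) h

lemma abs_timeDeriv_le {φ : ℝ → Torus n → ℝ} {K : NNReal}
    (hφ : ContDiffOn ℝ 1 (lift φ) (Ioo 0 T ×ˢ univ))
    (h : LipschitzOnWith K (lift φ) (Icc 0 T ×ˢ univ)) {t : ℝ} (ht : t ∈ Ioo 0 T) (x : Torus n) :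
    |timeDeriv φ t x| ≤ K := by
  obtain ⟨y, rfl⟩ := isOpenQuotientMap_proj.surjective x
  rw [timeDeriv_proj (differentiableAt_lift hφ ht y), ← Real.norm_eq_abs]
  refine (ContinuousLinearMap.le_opNorm _ _).trans ?_
  simpa [Prod.norm_def] using norm_fderiv_lift_le h ht y

lemma norm_spaceGrad_le {φ : ℝ → Torus n → ℝ} {K : NNReal}
    (hφ : ContDiffOn ℝ 1 (lift φ) (Ioo 0 T ×ˢ univ))
    (h : LipschitzOnWith K (lift φ) (Icc 0 T ×ˢ univ)) {t : ℝ} (ht : t ∈ Ioo 0 T) (x : Torus n) :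
    ‖spaceGrad φ t x‖ ≤ K := by
  obtain ⟨y, rfl⟩ := isOpenQuotientMap_proj.surjective x
  rw [spaceGrad_proj (differentiableAt_lift hφ ht y), LinearIsometryEquiv.norm_map]
  refine ContinuousLinearMap.opNorm_le_bound _ K.2 fun z => ?_
  refine ((fderiv ℝ (lift φ) (t, y)).le_opNorm (0, z)).trans ?_
  refine mul_le_mul (norm_fderiv_lift_le h ht y) ?_ (norm_nonneg _) K.2
  simp

/-- Every point of `ℝⁿ` has a representative modulo `ℤⁿ` in a fixed ball. -/
lemma exists_proj_eq_norm_le (y : Vel n) : ∃ z : Vel n, proj z = proj y ∧ ‖z‖ ≤ n := by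
  refine ⟨WithLp.toLp 2 fun i => Int.fract (y i), ?_, ?_⟩
  · ext i
    simp only [proj, Int.fract]
    rw [AddCircle.coe_sub]
    have : ((⌊y i⌋ : ℝ) : UnitAddCircle) = 0 := by
      rw [AddCircle.coe_eq_zero_iff]
      exact ⟨⌊y i⌋, by simp⟩
    rw [this, sub_zero]
  · rw [EuclideanSpace.norm_eq]
    have h1 : ∑ i : Fin n, ‖(WithLp.toLp 2 fun i => Int.fract (y i) : Vel n) i‖ ^ 2 ≤ n := by
      refine (Finset.sum_le_sum (g := fun _ => (1 : ℝ)) fun i _ => ?_).trans (by simp)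
      have h0 := Int.fract_nonneg (y i)
      have h2 := (Int.fract_lt_one (y i)).le
      simp only [Real.norm_eq_abs, sq_abs]
      nlinarith
    refine (Real.sqrt_le_sqrt h1).trans ?_
    rw [Real.sqrt_le_left (by positivity)]
    exact_mod_cast Nat.le_self_pow two_ne_zero n

lemma lift_add_of_proj_eq {φ : ℝ → Torus n → ℝ} {y z : Vel n} (h : proj z = proj y) :
    (fun q => lift φ (q + (0, z - y))) = lift φ := by
  ext ⟨t, w⟩
  have : proj (z - y) = 0 := by
    have h' := proj_add (z - y) y
    rw [sub_add_cancel, h] at h'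
    simpa using h'
  simp [lift, proj_add, this]

/-- The derivative is bounded on a compact set that meets every class modulo `ℤⁿ`, hence everywhere
by periodicity. The mean value inequality on the convex open slab then extends to the closed slab by
continuity. -/
lemma exists_lipschitzOnWith_lift (hT : 0 < T) {φ : ℝ → Torus n → ℝ}
    (h : ContDiffOn ℝ 1 (lift φ) (Icc 0 T ×ˢ univ)) :
    ∃ K : NNReal, LipschitzOnWith K (lift φ) (Icc 0 T ×ˢ univ) := by
  have hud : UniqueDiffOn ℝ (Icc 0 T ×ˢ (univ : Set (Vel n))) :=
    (uniqueDiffOn_Icc hT).prod uniqueDiffOn_univ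
  have hc := h.continuousOn_fderivWithin hud le_rfl
  have hK : IsCompact (Icc 0 T ×ˢ Metric.closedBall (0 : Vel n) n) :=
    isCompact_Icc.prod (isCompact_closedBall _ _)
  obtain ⟨C, hC⟩ := hK.exists_bound_of_continuousOn
    (hc.mono (prod_mono le_rfl (subset_univ _)))
  have hcl : closure (Ioo 0 T ×ˢ (univ : Set (Vel n))) = Icc 0 T ×ˢ univ := by
    rw [closure_prod_eq, closure_Ioo hT.ne, closure_univ]
  have hC' : LipschitzOnWith C.toNNReal (lift φ) (Ioo 0 T ×ˢ univ) := by
    refine Convex.lipschitzOnWith_of_nnnorm_fderiv_le (𝕜 := ℝ) ?_ ?_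
      ((convex_Ioo 0 T).prod convex_univ)
    · rintro ⟨t, y⟩ ⟨ht, -⟩
      exact differentiableAt_lift (h.mono (prod_mono Ioo_subset_Icc_self le_rfl)) ht y
    · rintro ⟨t, y⟩ ⟨ht, -⟩
      obtain ⟨z, hz, hzn⟩ := exists_proj_eq_norm_le y
      have h1 : fderiv ℝ (lift φ) (t, y) = fderiv ℝ (lift φ) (t, z) := by
        conv_lhs => rw [← lift_add_of_proj_eq (φ := φ) hz]
        rw [fderiv_comp_add_right]
        simp
      rw [h1, ← NNReal.coe_le_coe, coe_nnnorm,
        ← fderivWithin_of_mem_nhds (prod_mem_nhds (Icc_mem_nhds ht.1 ht.2) univ_mem)]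
      refine (hC (t, z) ⟨Ioo_subset_Icc_self ht, by simpa using hzn⟩).trans (Real.le_coe_toNNReal C)
  refine ⟨C.toNNReal, ?_⟩
  rw [← hcl]
  exact (lipschitzOnWith_closure_iff (by rw [hcl]; exact h.continuousOn)).2 hC'

lemma C10_subset_C1Lip (hT : 0 < T) : C10 n T ⊆ C1Lip n T := fun _ h =>
  ⟨h.1.mono (prod_mono Ioo_subset_Icc_self le_rfl), exists_lipschitzOnWith_lift hT h.1⟩

end

/-! ### Test functions, integrability against orbits and liftings, Young's inequality. -/

section

variable {n : ℕ} {T : ℝ}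

lemma timeDeriv_add {φ ψ : ℝ → Torus n → ℝ}
    (hφ : ContDiffOn ℝ 1 (lift φ) (Ioo 0 T ×ˢ univ))
    (hψ : ContDiffOn ℝ 1 (lift ψ) (Ioo 0 T ×ˢ univ)) {t : ℝ} (ht : t ∈ Ioo 0 T) (x : Torus n) :
    timeDeriv (φ + ψ) t x = timeDeriv φ t x + timeDeriv ψ t x :=
  ((hasDerivAt_timeDeriv hφ ht x).add (hasDerivAt_timeDeriv hψ ht x)).deriv

lemma spaceGrad_add {φ ψ : ℝ → Torus n → ℝ}
    (hφ : ContDiffOn ℝ 1 (lift φ) (Ioo 0 T ×ˢ univ))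
    (hψ : ContDiffOn ℝ 1 (lift ψ) (Ioo 0 T ×ˢ univ)) {t : ℝ} (ht : t ∈ Ioo 0 T) (x : Torus n) :
    spaceGrad (φ + ψ) t x = spaceGrad φ t x + spaceGrad ψ t x := by
  refine HasGradientAt.gradient ?_
  rw [hasGradientAt_iff_hasFDerivAt, map_add]
  exact (hasGradientAt_spaceGrad hφ ht x).hasFDerivAt.add
    (hasGradientAt_spaceGrad hψ ht x).hasFDerivAt

lemma timeDeriv_mul {η : ℝ → ℝ} (hη : Differentiable ℝ η) {φ : ℝ → Torus n → ℝ}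
    (hφ : ContDiffOn ℝ 1 (lift φ) (Ioo 0 T ×ˢ univ)) {t : ℝ} (ht : t ∈ Ioo 0 T) (x : Torus n) :
    timeDeriv (fun s x => η s * φ s x) t x = deriv η t * φ t x + η t * timeDeriv φ t x :=
  ((hη t).hasDerivAt.mul (hasDerivAt_timeDeriv hφ ht x)).deriv

lemma spaceGrad_mul (η : ℝ → ℝ) {φ : ℝ → Torus n → ℝ}
    (hφ : ContDiffOn ℝ 1 (lift φ) (Ioo 0 T ×ˢ univ)) {t : ℝ} (ht : t ∈ Ioo 0 T) (x : Torus n) :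
    spaceGrad (fun s x => η s * φ s x) t x = η t • spaceGrad φ t x := by
  refine HasGradientAt.gradient ?_
  rw [hasGradientAt_iff_hasFDerivAt, map_smul]
  exact (hasGradientAt_spaceGrad hφ ht x).hasFDerivAt.const_mul (η t)

lemma timeDeriv_smul (c : ℝ) {φ : ℝ → Torus n → ℝ}
    (hφ : ContDiffOn ℝ 1 (lift φ) (Ioo 0 T ×ˢ univ)) {t : ℝ} (ht : t ∈ Ioo 0 T) (x : Torus n) :
    timeDeriv (c • φ) t x = c * timeDeriv φ t x :=
  ((hasDerivAt_timeDeriv hφ ht x).const_mul c).deriv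

lemma spaceGrad_smul (c : ℝ) {φ : ℝ → Torus n → ℝ}
    (hφ : ContDiffOn ℝ 1 (lift φ) (Ioo 0 T ×ˢ univ)) {t : ℝ} (ht : t ∈ Ioo 0 T) (x : Torus n) :
    spaceGrad (c • φ) t x = c • spaceGrad φ t x :=
  spaceGrad_mul (fun _ => c) hφ ht x

/-- `C¹₀(Ω × [0,T])` as a vector space. -/
def C10Submodule (n : ℕ) (T : ℝ) : Submodule ℝ (ℝ → Torus n → ℝ) where
  carrier := C10 n T
  add_mem' {φ ψ} hφ hψ := ⟨hφ.1.add hψ.1, fun x => by simp [hφ.2.1, hψ.2.1],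
    fun x => by simp [hφ.2.2, hψ.2.2]⟩
  zero_mem' := ⟨contDiffOn_const (c := (0 : ℝ)), fun _ => rfl, fun _ => rfl⟩
  smul_mem' c φ hφ := ⟨contDiffOn_const.mul hφ.1, fun x => by simp [hφ.2.1],
    fun x => by simp [hφ.2.2]⟩

lemma contDiffOn_lift_of_C10 {φ : ℝ → Torus n → ℝ} (h : φ ∈ C10 n T) :
    ContDiffOn ℝ 1 (lift φ) (Ioo 0 T ×ˢ univ) :=
  h.1.mono (prod_mono Ioo_subset_Icc_self le_rfl)

/-- Cutting a function off near the end times yields an element of `C¹₀`. -/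
lemma mul_mem_C10 {η : ℝ → ℝ} (hη : ContDiff ℝ 1 η) (hs : tsupport η ⊆ Ioo 0 T)
    {φ : ℝ → Torus n → ℝ} (hφ : ContDiffOn ℝ 1 (lift φ) (Ioo 0 T ×ˢ univ)) :
    (fun t x => η t * φ t x) ∈ C10 n T := by
  refine ⟨?_, fun x => ?_, fun x => ?_⟩
  · rintro ⟨t, y⟩ -
    refine ContDiffAt.contDiffWithinAt ?_
    by_cases ht : t ∈ Ioo 0 T
    · have h1 : ContDiffAt ℝ 1 (lift φ) (t, y) :=
        hφ.contDiffAt ((isOpen_Ioo.prod isOpen_univ).mem_nhds ⟨ht, mem_univ _⟩)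
      exact (hη.contDiffAt.comp (t, y) contDiffAt_fst).mul h1
    · have h0 : η =ᶠ[𝓝 t] 0 := notMem_tsupport_iff_eventuallyEq.1 fun h => ht (hs h)
      refine (contDiffAt_const (c := (0 : ℝ))).congr_of_eventuallyEq ?_
      have h1 : Tendsto (Prod.fst : ℝ × Vel n → ℝ) (𝓝 (t, y)) (𝓝 t) := continuousAt_fst
      filter_upwards [h1.eventually h0] with q hq
      simp [lift, hq]
  · simp [image_eq_zero_of_notMem_tsupport fun h => lt_irrefl _ (hs h).1]
  · simp [image_eq_zero_of_notMem_tsupport fun h => lt_irrefl _ (hs h).2]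

section Measure

variable {μ : Measure (ℝ × Torus n)} {ν : Measure ((ℝ × Torus n) × Vel n)}
  {κ : Kernel ℝ (Torus n)}

lemma isFiniteMeasure_of_mem_Orbits (h : μ ∈ Orbits n T) : IsFiniteMeasure μ := by
  obtain ⟨κ, hκ, rfl⟩ := h
  infer_instance

lemma ae_of_ae_time (h : μ ∈ Orbits n T) {p : ℝ → Prop}
    (hp : ∀ᵐ t ∂(volume.restrict (Icc 0 T)), p t) : ∀ᵐ q ∂μ, p q.1 := by
  obtain ⟨κ, hκ, rfl⟩ := h
  have h1 : ((volume.restrict (Icc 0 T)).compProd κ).map Prod.fst = volume.restrict (Icc 0 T) :=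
    Measure.fst_compProd _ _
  rw [← h1] at hp
  exact ae_of_ae_map measurable_fst.aemeasurable hp

lemma ae_mem_Ioo (h : μ ∈ Orbits n T) : ∀ᵐ q ∂μ, q.1 ∈ Ioo 0 T := by
  refine ae_of_ae_time h ?_
  rw [← Measure.restrict_congr_set (Ioo_ae_eq_Icc (a := (0 : ℝ)) (b := T))]
  exact ae_restrict_mem measurableSet_Ioo

lemma ae_time_ne (h : μ ∈ Orbits n T) (t : ℝ) : ∀ᵐ q ∂μ, q.1 ≠ t :=
  ae_of_ae_time h (ae_restrict_of_ae (Measure.ae_ne volume t))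

/-- The time marginal is Lebesgue measure, so the end slices are null; derivatives need no control
at `t = 0` and `t = T`. -/
lemma aestronglyMeasurable_of_continuousOn {E : Type*} [TopologicalSpace E]
    [TopologicalSpace.PseudoMetrizableSpace E] [SecondCountableTopology E]
    (h : μ ∈ Orbits n T) {g : ℝ × Torus n → E}
    (hg : ContinuousOn g (Ioo 0 T ×ˢ univ)) : AEStronglyMeasurable g μ := by
  have h1 : μ.restrict (Ioo 0 T ×ˢ univ) = μ := by
    rw [Measure.restrict_eq_self_of_ae_mem]
    filter_upwards [ae_mem_Ioo h] with q hq using ⟨hq, mem_univ _⟩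
  rw [← h1]
  exact hg.aestronglyMeasurable (measurableSet_Ioo.prod MeasurableSet.univ)

lemma memLp_timeDeriv (h : μ ∈ Orbits n T) {φ : ℝ → Torus n → ℝ} (hφ : φ ∈ C1Lip n T)
    (p : ℝ≥0∞) : MemLp (fun q : ℝ × Torus n => timeDeriv φ q.1 q.2) p μ := by
  have := isFiniteMeasure_of_mem_Orbits h
  obtain ⟨h1, K, hK⟩ := hφ
  refine MemLp.of_bound (aestronglyMeasurable_of_continuousOn h (continuousOn_timeDeriv h1)) K ?_
  filter_upwards [ae_mem_Ioo h] with q hq using abs_timeDeriv_le h1 hK hq q.2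

lemma memLp_spaceGrad (h : μ ∈ Orbits n T) {φ : ℝ → Torus n → ℝ} (hφ : φ ∈ C1Lip n T)
    (p : ℝ≥0∞) : MemLp (fun q : ℝ × Torus n => spaceGrad φ q.1 q.2) p μ := by
  have := isFiniteMeasure_of_mem_Orbits h
  obtain ⟨h1, K, hK⟩ := hφ
  refine MemLp.of_bound (aestronglyMeasurable_of_continuousOn h (continuousOn_spaceGrad h1)) K ?_
  filter_upwards [ae_mem_Ioo h] with q hq using norm_spaceGrad_le h1 hK hq q.2

lemma integrable_timeDeriv (h : μ ∈ Orbits n T) {φ : ℝ → Torus n → ℝ} (hφ : φ ∈ C1Lip n T) :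
    Integrable (fun q : ℝ × Torus n => timeDeriv φ q.1 q.2) μ :=
  memLp_one_iff_integrable.1 (memLp_timeDeriv h hφ 1)

lemma integrable_sq_spaceGrad (h : μ ∈ Orbits n T) {φ : ℝ → Torus n → ℝ} (hφ : φ ∈ C1Lip n T) :
    Integrable (fun q : ℝ × Torus n => ‖spaceGrad φ q.1 q.2‖ ^ 2) μ :=
  (memLp_spaceGrad h hφ 2).integrable_norm_pow (by simp)

lemma hjIntegral_eq (h : μ ∈ Orbits n T) {φ : ℝ → Torus n → ℝ} (hφ : φ ∈ C1Lip n T) :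
    hjIntegral μ φ = ∫ q, timeDeriv φ q.1 q.2 ∂μ + (∫ q, ‖spaceGrad φ q.1 q.2‖ ^ 2 ∂μ) / 2 := by
  rw [hjIntegral, integral_add (integrable_timeDeriv h hφ)
    ((integrable_sq_spaceGrad h hφ).div_const 2), integral_div]

lemma measurePreserving_fst (h : ν.map Prod.fst = μ) : MeasurePreserving Prod.fst ν μ :=
  ⟨measurable_fst, h⟩

lemma isFiniteMeasure_of_map_fst (h : μ ∈ Orbits n T) (hν : ν.map Prod.fst = μ) :
    IsFiniteMeasure ν := by
  have := isFiniteMeasure_of_mem_Orbits h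
  subst hν
  exact Measure.isFiniteMeasure_of_map measurable_fst.aemeasurable

lemma memLp_velocity (hv : ∫⁻ q, ‖q.2‖ₑ ^ (2 : ℝ) ∂ν < ∞) :
    MemLp (fun q : (ℝ × Torus n) × Vel n => q.2) 2 ν := by
  refine ⟨measurable_snd.aestronglyMeasurable, ?_⟩
  rw [eLpNorm_lt_top_iff_lintegral_rpow_enorm_lt_top two_ne_zero ENNReal.ofNat_ne_top]
  simpa using hv

lemma integrable_velocity_inner (h : μ ∈ Orbits n T) (hν : ν.map Prod.fst = μ)
    (hv : ∫⁻ q, ‖q.2‖ₑ ^ (2 : ℝ) ∂ν < ∞) {φ : ℝ → Torus n → ℝ} (hφ : φ ∈ C1Lip n T) :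
    Integrable (fun q : (ℝ × Torus n) × Vel n => inner ℝ q.2 (spaceGrad φ q.1.1 q.1.2)) ν := by
  have h1 := (memLp_spaceGrad h hφ 2).comp_measurePreserving (measurePreserving_fst hν)
  refine ((memLp_velocity hv).norm.integrable_mul h1.norm).mono'
    ((memLp_velocity hv).aestronglyMeasurable.inner h1.aestronglyMeasurable)
    (Eventually.of_forall fun q => norm_inner_le_norm _ _)

lemma integrable_transport (h : μ ∈ Orbits n T) (hν : ν.map Prod.fst = μ)
    (hv : ∫⁻ q, ‖q.2‖ₑ ^ (2 : ℝ) ∂ν < ∞) {φ : ℝ → Torus n → ℝ} (hφ : φ ∈ C1Lip n T) :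
    Integrable (fun q : (ℝ × Torus n) × Vel n =>
      timeDeriv φ q.1.1 q.1.2 + inner ℝ q.2 (spaceGrad φ q.1.1 q.1.2)) ν :=
  ((measurePreserving_fst hν).integrable_comp_of_integrable (integrable_timeDeriv h hφ)).add
    (integrable_velocity_inner h hν hv hφ)

lemma ae_lifting_mem_Ioo (h : μ ∈ Orbits n T) (hν : ν.map Prod.fst = μ) :
    ∀ᵐ q ∂ν, q.1.1 ∈ Ioo 0 T := by
  have h1 := ae_mem_Ioo h
  rw [← hν] at h1
  exact ae_of_ae_map measurable_fst.aemeasurable h1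

lemma ae_lifting_time_ne (h : μ ∈ Orbits n T) (hν : ν.map Prod.fst = μ) (t : ℝ) :
    ∀ᵐ q ∂ν, q.1.1 ≠ t := by
  have h1 := ae_time_ne h t
  rw [← hν] at h1
  exact ae_of_ae_map measurable_fst.aemeasurable h1

lemma integral_lifting_eq (hν : ν.map Prod.fst = μ) {g : ℝ × Torus n → ℝ}
    (hg : AEStronglyMeasurable g μ) : ∫ q, g q.1 ∂ν = ∫ q, g q ∂μ := by
  subst hν
  exact (integral_map measurable_fst.aemeasurable hg).symm

/-- Young's inequality against a lifting. -/
lemma neg_transport_le (h : μ ∈ Orbits n T) (hν : ν.map Prod.fst = μ)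
    (hv : ∫⁻ q, ‖q.2‖ₑ ^ (2 : ℝ) ∂ν < ∞) {φ : ℝ → Torus n → ℝ} (hφ : φ ∈ C1Lip n T) :
    ∫ q, (timeDeriv φ q.1.1 q.1.2 + inner ℝ q.2 (spaceGrad φ q.1.1 q.1.2)) ∂ν - hjIntegral μ φ ≤
      (∫⁻ q, ‖q.2‖ₑ ^ (2 : ℝ) ∂ν).toReal / 2 := by
  have e1 : hjIntegral μ φ =
      ∫ q, (timeDeriv φ q.1.1 q.1.2 + ‖spaceGrad φ q.1.1 q.1.2‖ ^ 2 / 2) ∂ν :=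
    (integral_lifting_eq hν ((integrable_timeDeriv h hφ).add
      ((integrable_sq_spaceGrad h hφ).div_const 2)).aestronglyMeasurable).symm
  have e2 : (∫⁻ q, ‖q.2‖ₑ ^ (2 : ℝ) ∂ν).toReal = ∫ q, ‖q.2‖ ^ 2 ∂ν := by
    rw [integral_eq_lintegral_of_nonneg_ae (Eventually.of_forall fun q => by positivity)
      (measurable_snd.norm.pow_const 2).aestronglyMeasurable]
    congr 1
    refine lintegral_congr fun q => ?_
    rw [← ofReal_norm, ENNReal.ofReal_rpow_of_nonneg (norm_nonneg _) zero_le_two]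
    simp
  have i1 : Integrable (fun q : (ℝ × Torus n) × Vel n =>
      timeDeriv φ q.1.1 q.1.2 + ‖spaceGrad φ q.1.1 q.1.2‖ ^ 2 / 2) ν :=
    (measurePreserving_fst hν).integrable_comp_of_integrable ((integrable_timeDeriv h hφ).add
      ((integrable_sq_spaceGrad h hφ).div_const 2))
  rw [e1, e2, ← integral_sub (integrable_transport h hν hv hφ) i1, ← integral_div]
  refine integral_mono ((integrable_transport h hν hv hφ).sub i1)
    (((memLp_velocity hv).integrable_norm_pow (by simp)).div_const 2) fun q => ?_
  -- Expanding `|v - ∇φ|² ≥ 0` gives the pointwise Young inequality; the time derivatives cancel.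
  have h3 := norm_sub_sq_real q.2 (spaceGrad φ q.1.1 q.1.2)
  have h4 := sq_nonneg ‖q.2 - spaceGrad φ q.1.1 q.1.2‖
  simp only
  linarith

end Measure

end

/-! ### The continuity equation integrated in time, with boundary terms. -/

section

variable {n : ℕ} {T : ℝ}

/-- A primitive of a continuous function of zero mean supported in `(0,T)` is supported in
`(0,T)`. -/
lemma tsupport_primitive_subset {K : Set ℝ} (hK : IsCompact K) (hKT : K ⊆ Ioo 0 T)
    {g : ℝ → ℝ} (hg : ∀ t ∉ K, g t = 0) (h0 : ∫ t, g t = 0) :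
    tsupport (fun t => ∫ s in (0 : ℝ)..t, g s) ⊆ Ioo 0 T := by
  rcases K.eq_empty_or_nonempty with rfl | hne
  · have : (fun t => ∫ s in (0 : ℝ)..t, g s) = 0 := by
      ext t
      simp [show g = 0 from funext fun t => hg t (notMem_empty t)]
    rw [this]; simp
  obtain ⟨ha, hb⟩ := And.intro (hKT (hK.sInf_mem hne)) (hKT (hK.sSup_mem hne))
  have hsub : K ⊆ Icc (sInf K) (sSup K) := fun t ht =>
    ⟨csInf_le hK.bddBelow ht, le_csSup hK.bddAbove ht⟩
  -- The primitive vanishes off `[inf K, sup K]`: before it nothing has been integrated, and after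
  -- it the whole integral, which is zero.
  refine (closure_minimal ?_ isClosed_Icc).trans (Icc_subset_Ioo ha.1 hb.2)
  intro t ht
  by_contra hmem
  refine ht ?_
  rcases lt_or_ge t (sInf K) with h1 | h1
  · have : EqOn g (fun _ => 0) (uIcc 0 t) := fun s hs => hg s fun hsK => by
      have h2 := (hsub hsK).1
      have h3 := hs.2
      have : max 0 t < sInf K := max_lt ha.1 h1
      exact absurd (h2.trans h3) (not_le.2 this)
    simp [intervalIntegral.integral_congr this]
  · have h2 : sSup K < t := by
      by_contra h
      exact hmem ⟨h1, not_lt.1 h⟩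
    change ∫ s in (0 : ℝ)..t, g s = 0
    rw [intervalIntegral.integral_eq_integral_of_support_subset, h0]
    intro s hs
    have hsK : s ∈ K := by
      by_contra h
      exact hs (hg s h)
    exact ⟨(hKT hsK).1, (hsub hsK).2.trans h2.le⟩

/-- The du Bois-Reymond lemma on `[0,T]`. -/
lemma exists_ae_eq_const_of_integral_deriv_mul_eq_zero (hT : 0 < T) {f : ℝ → ℝ}
    (hf : IntegrableOn f (Icc 0 T))
    (h : ∀ η : ℝ → ℝ, ContDiff ℝ 1 η → tsupport η ⊆ Ioo 0 T →
      ∫ t in Icc 0 T, deriv η t * f t = 0) :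
    ∃ c, ∀ᵐ t ∂(volume.restrict (Icc 0 T)), f t = c := by
  let b : ContDiffBump (T / 2) := ⟨T / 8, T / 4, by positivity, by linarith⟩
  set ρ : ℝ → ℝ := b.normed volume with hρ
  have hρc : Continuous ρ := b.contDiff_normed.continuous (n := 0)
  have hρs : tsupport ρ ⊆ Ioo 0 T := by
    rw [hρ, b.tsupport_normed_eq, Real.closedBall_eq_Icc]
    refine Icc_subset_Ioo ?_ ?_ <;> simp only [b] <;> linarith
  have hρi : ∫ t, ρ t = 1 := b.integral_normed
  have hmul : ∀ g : ℝ → ℝ, Continuous g → IntegrableOn (fun t => g t * f t) (Icc 0 T) :=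
    fun g hg => hf.continuousOn_mul hg.continuousOn isCompact_Icc
  refine ⟨∫ t in Icc 0 T, ρ t * f t, ?_⟩
  set c := ∫ t in Icc 0 T, ρ t * f t with hc
  have key : ∀ᵐ t, t ∈ Ioo 0 T → f t - c = 0 := by
    refine IsOpen.ae_eq_zero_of_integral_contDiff_smul_eq_zero isOpen_Ioo ?_ ?_
    · refine IntegrableOn.locallyIntegrableOn ?_
      exact (hf.mono_set Ioo_subset_Icc_self).sub (integrableOn_const (by simp))
    · intro θ hθ hθc hθs
      have hθcont := hθ.continuous
      -- Subtracting a multiple of the unit-mass bump makes the mean zero, so that the primitive of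
      -- `g` is an admissible `η`. This is why the constant `c` is the `ρ`-average of `f`.
      set g : ℝ → ℝ := fun t => θ t - (∫ s, θ s) * ρ t with hg
      have hgc : Continuous g := by fun_prop
      have hgi : ∫ t, g t = 0 := by
        rw [hg, integral_sub (hθcont.integrable_of_hasCompactSupport hθc)
          ((hρc.integrable_of_hasCompactSupport b.hasCompactSupport_normed).const_mul _),
          integral_const_mul, hρi, mul_one, sub_self]
      have hd : deriv (fun t => ∫ s in (0 : ℝ)..t, g s) = g :=
        funext fun t => hgc.deriv_integral g 0 t
      have hη1 : ContDiff ℝ 1 (fun t => ∫ s in (0 : ℝ)..t, g s) := by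
        rw [contDiff_one_iff_deriv, hd]
        exact ⟨fun t => (hgc.integral_hasStrictDerivAt 0 t).hasDerivAt.differentiableAt, hgc⟩
      have hη2 : tsupport (fun t => ∫ s in (0 : ℝ)..t, g s) ⊆ Ioo 0 T := by
        refine tsupport_primitive_subset (K := tsupport θ ∪ tsupport ρ)
          (hθc.isCompact.union b.hasCompactSupport_normed.isCompact)
          (union_subset hθs hρs) (fun t ht => ?_) hgi
        rw [mem_union, not_or] at ht
        simp [hg, image_eq_zero_of_notMem_tsupport ht.1, image_eq_zero_of_notMem_tsupport ht.2]
      have h1 := h _ hη1 hη2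
      rw [hd] at h1
      have h2 : ∫ t in Icc 0 T, g t * f t =
          (∫ t in Icc 0 T, θ t * f t) - (∫ s, θ s) * c := by
        rw [hc, ← integral_const_mul, ← integral_sub (hmul θ hθcont) ((hmul ρ hρc).const_mul _)]
        refine integral_congr_ae (Eventually.of_forall fun t => ?_)
        simp only [hg]; ring
      have hz : ∀ t ∉ Icc 0 T, θ t = 0 := fun t ht =>
        image_eq_zero_of_notMem_tsupport fun h => ht (Ioo_subset_Icc_self (hθs h))
      have h3 : ∫ s, θ s = ∫ s in Icc 0 T, θ s :=
        (setIntegral_eq_integral_of_forall_compl_eq_zero hz).symm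
      rw [← setIntegral_eq_integral_of_forall_compl_eq_zero (s := Icc 0 T)
        (fun t ht => by simp [hz t ht])]
      have h4 : ∫ t in Icc 0 T, θ t • (f t - c) =
          (∫ t in Icc 0 T, θ t * f t) - (∫ s in Icc 0 T, θ s) * c := by
        rw [← integral_mul_const, ← integral_sub (hmul θ hθcont)
          ((hθcont.integrableOn_Icc).mul_const _)]
        refine integral_congr_ae (Eventually.of_forall fun t => ?_)
        simp only [smul_eq_mul]; ring
      rw [h4, ← h3, ← h2, h1]
  rw [← Measure.restrict_congr_set (Ioo_ae_eq_Icc (a := (0 : ℝ)) (b := T)),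
    ae_restrict_iff' measurableSet_Ioo]
  filter_upwards [key] with t ht hmem using sub_eq_zero.1 (ht hmem)

section Truncated

variable {α : Type*} [MeasurableSpace α] {ν : Measure α} {τ : α → ℝ} {g : α → ℝ}

/-- Dominated convergence: since `τ` has no atoms, the indicator of `τ q ≤ t` is locally constant in
`t` at each given time for almost every `q`. -/
lemma continuous_setIntegral_le (hτ : Measurable τ) (hne : ∀ t, ∀ᵐ q ∂ν, τ q ≠ t)
    (hg : Integrable g ν) : Continuous fun t => ∫ q in {q | τ q ≤ t}, g q ∂ν := by
  have hm : ∀ t, MeasurableSet {q | τ q ≤ t} := fun t => measurableSet_le hτ measurable_const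
  simp_rw [← integral_indicator (hm _)]
  rw [continuous_iff_continuousAt]
  intro t
  refine continuousAt_of_dominated (bound := fun q => ‖g q‖) ?_ ?_ hg.norm ?_
  · exact Eventually.of_forall fun s => hg.aestronglyMeasurable.indicator (hm s)
  · exact Eventually.of_forall fun s => Eventually.of_forall fun q => norm_indicator_le_norm_self _ _
  · filter_upwards [hne t] with q hq
    rcases lt_or_gt_of_ne hq with h | h
    · refine (continuousAt_const (y := g q)).congr ?_
      filter_upwards [lt_mem_nhds h] with s hs
      simp [indicator_of_mem, hs.le]
    · refine (continuousAt_const (y := (0 : ℝ))).congr ?_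
      filter_upwards [gt_mem_nhds h] with s hs
      simp [indicator, not_le.2 hs]

/-- Integration by parts for a cumulative integral. By Fubini each `q` contributes `g q` times the
integral of `η'` over `[τ q, T]`, which is `-η (τ q)` because `η T = 0`. -/
lemma integral_deriv_mul_setIntegral_le [SFinite ν] (hτ : Measurable τ)
    (hmem : ∀ᵐ q ∂ν, τ q ∈ Ioo 0 T) (hg : Integrable g ν) {η : ℝ → ℝ} (hη : ContDiff ℝ 1 η)
    (hs : tsupport η ⊆ Ioo 0 T) :
    ∫ t in Icc 0 T, deriv η t * ∫ q in {q | τ q ≤ t}, g q ∂ν = -∫ q, η (τ q) * g q ∂ν := by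
  have hm : ∀ t, MeasurableSet {q | τ q ≤ t} := fun t => measurableSet_le hτ measurable_const
  have hd : Continuous (deriv η) := hη.continuous_deriv le_rfl
  have hi : Integrable (Function.uncurry fun t q => {q | τ q ≤ t}.indicator
      (fun q => deriv η t * g q) q) ((volume.restrict (Icc 0 T)).prod ν) := by
    have h1 : Integrable (fun p : ℝ × α => deriv η p.1 * g p.2)
        ((volume.restrict (Icc 0 T)).prod ν) :=
      Integrable.mul_prod (f := deriv η) hd.integrableOn_Icc hg
    have hS : MeasurableSet {p : ℝ × α | τ p.2 ≤ p.1} :=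
      measurableSet_le (hτ.comp measurable_snd) measurable_fst
    refine (h1.indicator hS).congr (Eventually.of_forall fun p => ?_)
    simp [Function.uncurry, indicator]
  have e1 : ∀ t, deriv η t * ∫ q in {q | τ q ≤ t}, g q ∂ν =
      ∫ q, {q | τ q ≤ t}.indicator (fun q => deriv η t * g q) q ∂ν := fun t => by
    rw [integral_indicator (hm t), integral_const_mul]
  simp_rw [e1]
  rw [integral_integral_swap hi, ← integral_neg]
  refine integral_congr_ae ?_
  filter_upwards [hmem] with q hq
  have e2 : ∀ t, {q | τ q ≤ t}.indicator (fun q => deriv η t * g q) q =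
      (Ici (τ q)).indicator (deriv η) t * g q := fun t => by
    by_cases h : τ q ≤ t <;> simp [indicator, h]
  simp_rw [e2]
  rw [integral_mul_const, setIntegral_indicator measurableSet_Ici]
  have e3 : Icc 0 T ∩ Ici (τ q) = Icc (τ q) T := by
    ext t
    simp only [mem_inter_iff, mem_Icc, mem_Ici]
    exact ⟨fun h => ⟨h.2, h.1.2⟩, fun h => ⟨⟨hq.1.le.trans h.1, h.2⟩, h.1⟩⟩
  rw [e3, integral_Icc_eq_integral_Ioc, ← intervalIntegral.integral_of_le hq.2.le,
    intervalIntegral.integral_deriv_eq_sub (fun t _ => (hη.differentiable one_ne_zero) t)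
      (hd.intervalIntegrable _ _),
    image_eq_zero_of_notMem_tsupport fun h => lt_irrefl _ (hs h).2]
  ring

end Truncated

section Measure

variable {μ : Measure (ℝ × Torus n)} {ν : Measure ((ℝ × Torus n) × Vel n)}
  {κ : Kernel ℝ (Torus n)}

lemma exists_abs_le_of_C1Lip {φ : ℝ → Torus n → ℝ} {K : NNReal}
    (h : LipschitzOnWith K (lift φ) (Icc 0 T ×ˢ univ)) :
    ∃ C, ∀ t ∈ Icc 0 T, ∀ x, |φ t x| ≤ C := by
  refine ⟨|φ 0 (proj 0)| + K * max T n, fun t ht x => ?_⟩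
  obtain ⟨y, rfl⟩ := isOpenQuotientMap_proj.surjective x
  obtain ⟨z, hz, hzn⟩ := exists_proj_eq_norm_le y
  have h1 := h.dist_le_mul (t, z) ⟨ht, mem_univ _⟩ (0, 0) ⟨⟨le_rfl, ht.1.trans ht.2⟩, mem_univ _⟩
  have h2 : dist (t, z) ((0 : ℝ), (0 : Vel n)) ≤ max T n := by
    rw [Prod.dist_eq]
    refine max_le_max ?_ ?_
    · simpa [abs_of_nonneg ht.1] using ht.2
    · simpa using hzn
  have h3 : |φ t (proj z) - φ 0 (proj 0)| ≤ K * max T n :=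
    h1.trans (mul_le_mul_of_nonneg_left h2 K.2)
  rw [← hz]
  have h4 := abs_sub_abs_le_abs_sub (φ t (proj z)) (φ 0 (proj 0))
  linarith

lemma continuous_of_C1Lip {φ : ℝ → Torus n → ℝ} {K : NNReal}
    (h : LipschitzOnWith K (lift φ) (Icc 0 T ×ˢ univ)) {t : ℝ} (ht : t ∈ Icc 0 T) :
    Continuous (φ t) := by
  rw [← isOpenQuotientMap_proj.continuous_comp_iff]
  have h1 : Continuous fun y : Vel n => (t, y) := by fun_prop
  exact h.continuousOn.comp_continuous h1 fun y => ⟨ht, mem_univ _⟩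

lemma integrable_of_C1Lip (h : μ ∈ Orbits n T) {φ : ℝ → Torus n → ℝ} (hφ : φ ∈ C1Lip n T) :
    Integrable (fun q : ℝ × Torus n => φ q.1 q.2) μ := by
  have := isFiniteMeasure_of_mem_Orbits h
  obtain ⟨h1, K, hK⟩ := hφ
  obtain ⟨C, hC⟩ := exists_abs_le_of_C1Lip hK
  refine Integrable.of_bound (aestronglyMeasurable_of_continuousOn h
    (continuousOn_of_comp_proj h1.continuousOn)) C ?_
  filter_upwards [ae_mem_Ioo h] with q hq using hC _ (Ioo_subset_Icc_self hq) q.2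

/-- `∫ (φ_t + v · ∇ₓ φ) dν` over the times up to `t`. -/
noncomputable def transportUpTo (ν : Measure ((ℝ × Torus n) × Vel n)) (φ : ℝ → Torus n → ℝ)
    (t : ℝ) : ℝ :=
  ∫ q in {q | q.1.1 ≤ t}, (timeDeriv φ q.1.1 q.1.2 + inner ℝ q.2 (spaceGrad φ q.1.1 q.1.2)) ∂ν

lemma continuous_transportUpTo (h : μ ∈ Orbits n T) (hν : ν.map Prod.fst = μ)
    (hv : ∫⁻ q, ‖q.2‖ₑ ^ (2 : ℝ) ∂ν < ∞) {φ : ℝ → Torus n → ℝ} (hφ : φ ∈ C1Lip n T) :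
    Continuous (transportUpTo ν φ) :=
  continuous_setIntegral_le (τ := fun q : (ℝ × Torus n) × Vel n => q.1.1)
    (measurable_fst.comp measurable_fst) (ae_lifting_time_ne h hν)
    (integrable_transport h hν hv hφ)

/-- Along an orbit, `∫ φ(t,x) μ_(t)(dx)` is for almost every `t` a primitive of
`∫ (φ_t + v · ∇ₓ φ) dν_(t)`. -/
lemma exists_timeMean_ae_eq (hT : 0 < T) (hκ : Decomposes T μ κ) (hν : IsLifting T μ ν)
    (hv : ∫⁻ q, ‖q.2‖ₑ ^ (2 : ℝ) ∂ν < ∞) {φ : ℝ → Torus n → ℝ} (hφ : φ ∈ C1Lip n T) :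
    ∃ c, ∀ᵐ t ∂(volume.restrict (Icc 0 T)), ∫ x, φ t x ∂(κ t) = transportUpTo ν φ t + c := by
  have hμ : μ ∈ Orbits n T := ⟨κ, hκ⟩
  have := isFiniteMeasure_of_map_fst hμ hν.1
  have hmk := hκ.1
  have hiφ := integrable_of_C1Lip hμ hφ
  have hF : IntegrableOn (fun t => ∫ x, φ t x ∂(κ t)) (Icc 0 T) := by
    rw [hκ.2] at hiφ
    simpa [IntegrableOn] using Integrable.integral_compProd hiφ
  have hBc := continuous_transportUpTo hμ hν.1 hv hφ
  have hB : IntegrableOn (transportUpTo ν φ) (Icc 0 T) := hBc.integrableOn_Icc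
  suffices H : _ by
    obtain ⟨c, hc⟩ := exists_ae_eq_const_of_integral_deriv_mul_eq_zero hT (hF.sub hB) H
    exact ⟨c, hc.mono fun t ht => by simpa [sub_eq_iff_eq_add, add_comm] using ht⟩
  intro η hη hs
  have hd : Continuous (deriv η) := hη.continuous_deriv le_rfl
  -- The lifting is tested with `η φ`, whose transport integrand is `η' φ + η (φ_t + v · ∇φ)`.
  -- Integrating the second term by parts shows that `η'` annihilates the difference of the two
  -- functions of time.
  have h1 := (hν.2 _ (mul_mem_C10 hη hs hφ.1)).2
  have h2 := integral_deriv_mul_setIntegral_le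
    (τ := fun q : (ℝ × Torus n) × Vel n => q.1.1) (measurable_fst.comp measurable_fst)
    (ae_lifting_mem_Ioo hμ hν.1) (integrable_transport hμ hν.1 hv hφ) hη hs
  have hcs : HasCompactSupport η :=
    HasCompactSupport.of_support_subset_isCompact isCompact_Icc
      ((subset_tsupport η).trans (hs.trans Ioo_subset_Icc_self))
  obtain ⟨C, hC⟩ := hcs.deriv.exists_bound_of_continuous hd
  have i1 : Integrable (fun q : ℝ × Torus n => deriv η q.1 * φ q.1 q.2) μ :=
    hiφ.bdd_mul (c := C) (hd.comp continuous_fst).aestronglyMeasurable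
      (Eventually.of_forall fun q => hC q.1)
  have i2 : Integrable (fun q : (ℝ × Torus n) × Vel n => η q.1.1 *
      (timeDeriv φ q.1.1 q.1.2 + inner ℝ q.2 (spaceGrad φ q.1.1 q.1.2))) ν := by
    obtain ⟨C, hC⟩ := hcs.exists_bound_of_continuous hη.continuous
    exact (integrable_transport hμ hν.1 hv hφ).bdd_mul (c := C)
      (hη.continuous.comp (continuous_fst.comp continuous_fst)).aestronglyMeasurable
      (Eventually.of_forall fun q => hC q.1.1)
  have e1 : ∫ q, deriv η q.1.1 * φ q.1.1 q.1.2 ∂ν +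
      ∫ q, η q.1.1 * (timeDeriv φ q.1.1 q.1.2 + inner ℝ q.2 (spaceGrad φ q.1.1 q.1.2)) ∂ν = 0 := by
    have i3 : Integrable (fun q : (ℝ × Torus n) × Vel n => deriv η q.1.1 * φ q.1.1 q.1.2) ν :=
      (measurePreserving_fst hν.1).integrable_comp_of_integrable i1
    rw [← integral_add i3 i2, ← h1]
    refine integral_congr_ae ?_
    filter_upwards [ae_lifting_mem_Ioo hμ hν.1] with q hq
    rw [timeDeriv_mul (hη.differentiable one_ne_zero) hφ.1 hq, spaceGrad_mul η hφ.1 hq,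
      inner_smul_right]
    ring
  have e2 : ∫ q, deriv η q.1.1 * φ q.1.1 q.1.2 ∂ν =
      ∫ t in Icc 0 T, deriv η t * ∫ x, φ t x ∂(κ t) := by
    rw [integral_lifting_eq hν.1 (g := fun q => deriv η q.1 * φ q.1 q.2) i1.aestronglyMeasurable]
    rw [hκ.2] at i1 ⊢
    rw [Measure.integral_compProd i1]
    simp_rw [integral_const_mul]
  have e3 : ∫ t in Icc 0 T, deriv η t * (∫ x, φ t x ∂(κ t) - transportUpTo ν φ t) =
      (∫ t in Icc 0 T, deriv η t * ∫ x, φ t x ∂(κ t)) -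
        ∫ t in Icc 0 T, deriv η t * transportUpTo ν φ t := by
    rw [← integral_sub (hF.continuousOn_mul hd.continuousOn isCompact_Icc)
      (hB.continuousOn_mul hd.continuousOn isCompact_Icc)]
    simp_rw [mul_sub]
  have e4 : ∫ t in Icc 0 T, deriv η t * transportUpTo ν φ t = _ := h2
  change ∫ t in Icc 0 T, deriv η t * (∫ x, φ t x ∂(κ t) - transportUpTo ν φ t) = 0
  rw [e3, e4, ← e2]
  linarith

/-- The continuity equation tested against functions that do not vanish at the end times. -/
lemma integral_transport_eq (hT : 0 < T) (hκ : Decomposes T μ κ)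
    (hcont : ∀ f : C(Torus n, ℝ), ContinuousOn (fun t => ∫ x, f x ∂(κ t)) (Icc 0 T))
    (hν : IsLifting T μ ν) (hv : ∫⁻ q, ‖q.2‖ₑ ^ (2 : ℝ) ∂ν < ∞)
    {φ : ℝ → Torus n → ℝ} (hφ : φ ∈ C1Lip n T) :
    ∫ q, (timeDeriv φ q.1.1 q.1.2 + inner ℝ q.2 (spaceGrad φ q.1.1 q.1.2)) ∂ν =
      ∫ x, φ T x ∂(κ T) - ∫ x, φ 0 x ∂(κ 0) := by
  have hμ : μ ∈ Orbits n T := ⟨κ, hκ⟩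
  have hmk := hκ.1
  obtain ⟨-, K, hK⟩ := id hφ
  -- Weak continuity handles the frozen function `φ s`, and the Lipschitz bound in time handles `φ t
  -- - φ s`, uniformly in `x`.
  have hFc : ContinuousOn (fun t => ∫ x, φ t x ∂(κ t)) (Icc 0 T) := by
    intro s hs
    have h1 := hcont ⟨φ s, continuous_of_C1Lip hK hs⟩ s hs
    have h2 : Tendsto (fun t => ∫ x, φ t x ∂(κ t) - ∫ x, φ s x ∂(κ t)) (𝓝[Icc 0 T] s) (𝓝 0) := by
      refine squeeze_zero_norm' (a := fun t => K * dist t s) ?_ ?_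
      · filter_upwards [self_mem_nhdsWithin] with t ht
        have i : ∀ r ∈ Icc 0 T, Integrable (φ r) (κ t) := fun r hr =>
          (continuous_of_C1Lip hK hr).integrable_of_hasCompactSupport
            (HasCompactSupport.of_compactSpace _)
        rw [← integral_sub (i t ht) (i s hs)]
        refine (norm_integral_le_of_norm_le_const (C := K * dist t s)
          (Eventually.of_forall fun x => ?_)).trans (by simp)
        obtain ⟨y, rfl⟩ := isOpenQuotientMap_proj.surjective x
        refine (hK.dist_le_mul (t, y) ⟨ht, mem_univ _⟩ (s, y) ⟨hs, mem_univ _⟩).trans_eq ?_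
        simp [Prod.dist_eq]
      · have : ContinuousAt (fun t => K * dist t s) s := by fun_prop
        have := this.tendsto
        simp only [dist_self, mul_zero] at this
        exact this.mono_left nhdsWithin_le_nhds
    have h3 := h2.add h1
    simp only [ContinuousMap.coe_mk, sub_add_cancel, zero_add] at h3
    exact h3
  obtain ⟨c, hc⟩ := exists_timeMean_ae_eq hT hκ hν hv hφ
  -- Both sides are continuous, so the a.e. identity holds at every time, in particular at the two
  -- end times.
  have hE := Measure.eqOn_Icc_of_ae_eq volume hT.ne hc hFc
    ((continuous_transportUpTo hμ hν.1 hv hφ).add continuous_const).continuousOn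
  have h0 := hE (left_mem_Icc.2 hT.le)
  have h1 := hE (right_mem_Icc.2 hT.le)
  simp only at h0 h1
  have b0 : transportUpTo ν φ 0 = 0 := by
    rw [transportUpTo, Measure.restrict_eq_zero.2, integral_zero_measure]
    have := ae_lifting_mem_Ioo hμ hν.1
    rw [ae_iff] at this
    refine measure_mono_null (fun q hq => ?_) this
    exact fun h => absurd h.1 (not_lt.2 hq)
  have b1 : transportUpTo ν φ T =
      ∫ q, (timeDeriv φ q.1.1 q.1.2 + inner ℝ q.2 (spaceGrad φ q.1.1 q.1.2)) ∂ν := by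
    rw [transportUpTo, Measure.restrict_eq_self_of_ae_mem]
    filter_upwards [ae_lifting_mem_Ioo hμ hν.1] with q hq using hq.2.le
  rw [h0, h1, b0, b1]
  ring

end Measure

end

/-! ### Fourier monomials and the weakly continuous version of an orbit. -/

section

variable {n : ℕ} {T : ℝ}

/-- The real (`b = false`) and imaginary (`b = true`) parts of the exponential monomials. -/
noncomputable def trig (k : Fin n → ℤ) : Bool → C(Torus n, ℝ)
  | false => (⟨Complex.re, Complex.continuous_re⟩ : C(ℂ, ℝ)).comp (UnitAddTorus.mFourier k)
  | true => (⟨Complex.im, Complex.continuous_im⟩ : C(ℂ, ℝ)).comp (UnitAddTorus.mFourier k)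

lemma contDiff_trig (k : Fin n → ℤ) (b : Bool) :
    ContDiff ℝ 1 fun y : Vel n => trig k b (proj y) := by
  have h : ContDiff ℝ 1 fun y : Vel n => UnitAddTorus.mFourier k (proj y) := by
    simp only [UnitAddTorus.mFourier, ContinuousMap.coe_mk, proj]
    refine contDiff_prod fun i _ => ?_
    simp_rw [fourier_coe_apply]
    have h1 : ContDiff ℝ 1 fun y : Vel n => ((y i : ℝ) : ℂ) :=
      Complex.ofRealCLM.contDiff.comp (EuclideanSpace.proj (𝕜 := ℝ) i).contDiff
    exact ((contDiff_const.mul h1).div_const _).cexp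
  cases b
  · exact Complex.reCLM.contDiff.comp h
  · exact Complex.imCLM.contDiff.comp h

/-- The trigonometric polynomials are dense in the real continuous functions on the torus. -/
lemma eq_top_of_trig_mem (V : Submodule ℝ C(Torus n, ℝ)) (hV : IsClosed (V : Set C(Torus n, ℝ)))
    (h : ∀ k b, trig k b ∈ V) : V = ⊤ := by
  let re : C(Torus n, ℂ) → C(Torus n, ℝ) := (⟨Complex.re, Complex.continuous_re⟩ : C(ℂ, ℝ)).comp
  let im : C(Torus n, ℂ) → C(Torus n, ℝ) := (⟨Complex.im, Complex.continuous_im⟩ : C(ℂ, ℝ)).comp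
  -- The density theorem is complex while `V` is real. Functions with both real and imaginary parts
  -- in `V` form a complex subspace, to which the theorem applies.
  let W : Submodule ℂ C(Torus n, ℂ) :=
    { carrier := {g | re g ∈ V ∧ im g ∈ V}
      add_mem' := by
        rintro f g ⟨hf, hf'⟩ ⟨hg, hg'⟩
        exact ⟨V.add_mem hf hg, V.add_mem hf' hg'⟩
      zero_mem' := ⟨V.zero_mem, V.zero_mem⟩
      smul_mem' := by
        rintro c g ⟨hg, hg'⟩
        constructor
        · convert V.sub_mem (V.smul_mem c.re hg) (V.smul_mem c.im hg')
          ext x; simp [re, im]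
        · convert V.add_mem (V.smul_mem c.re hg') (V.smul_mem c.im hg)
          ext x; simp [re, im] }
  have hW : IsClosed (W : Set C(Torus n, ℂ)) :=
    (hV.preimage (ContinuousMap.continuous_postcomp _)).inter
      (hV.preimage (ContinuousMap.continuous_postcomp _))
  have hWt : W = ⊤ := by
    rw [eq_top_iff, ← UnitAddTorus.span_mFourier_closure_eq_top]
    refine Submodule.topologicalClosure_minimal _ (Submodule.span_le.2 ?_) hW
    rintro _ ⟨k, rfl⟩
    exact ⟨h k false, h k true⟩
  rw [eq_top_iff]
  intro f _
  have hf : (⟨Complex.ofReal, Complex.continuous_ofReal⟩ : C(ℝ, ℂ)).comp f ∈ W := by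
    rw [hWt]; trivial
  exact hf.1

lemma integrable_continuousMap (m : Measure (Torus n)) [IsFiniteMeasure m] (f : C(Torus n, ℝ)) :
    Integrable f m :=
  f.continuous.integrable_of_hasCompactSupport (HasCompactSupport.of_compactSpace _)

lemma dist_integral_le (m : Measure (Torus n)) [IsProbabilityMeasure m] (f g : C(Torus n, ℝ)) :
    dist (∫ x, f x ∂m) (∫ x, g x ∂m) ≤ dist f g := by
  rw [dist_eq_norm, ← integral_sub (integrable_continuousMap m f) (integrable_continuousMap m g)]
  refine (norm_integral_le_of_norm_le_const (C := dist f g)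
    (Eventually.of_forall fun x => ?_)).trans (by simp)
  rw [← dist_eq_norm]
  exact ContinuousMap.dist_apply_le_dist x

/-- Integrals along a family of probability measures depend continuously on the parameter as soon
as those of trigonometric monomials do. -/
lemma continuous_integral_of_trig {ι : Type*} [TopologicalSpace ι] {m : ι → Measure (Torus n)}
    [∀ i, IsProbabilityMeasure (m i)]
    (h : ∀ k b, Continuous fun i => ∫ x, trig k b x ∂(m i)) (f : C(Torus n, ℝ)) :
    Continuous fun i => ∫ x, f x ∂(m i) := by
  let V : Submodule ℝ C(Torus n, ℝ) :=
    { carrier := {f | Continuous fun i => ∫ x, f x ∂(m i)}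
      add_mem' := fun {f g} hf hg => by
        refine (Continuous.add hf hg).congr fun i => ?_
        exact (integral_add (integrable_continuousMap _ f) (integrable_continuousMap _ g)).symm
      zero_mem' := by simpa using continuous_const
      smul_mem' := fun c f hf => by
        refine (Continuous.const_smul hf c).congr fun i => ?_
        exact (integral_const_mul c _).symm }
  -- Integration against probability measures is 1-Lipschitz in `f`, uniformly in the parameter, so
  -- uniform limits preserve continuity.
  have hV : IsClosed (V : Set C(Torus n, ℝ)) := by
    refine isClosed_of_closure_subset fun f hf => ?_
    refine continuous_of_uniform_approx_of_continuous fun u hu => ?_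
    obtain ⟨ε, hε, hεu⟩ := Metric.mem_uniformity_dist.1 hu
    obtain ⟨g, hg, hfg⟩ := Metric.mem_closure_iff.1 hf ε hε
    exact ⟨_, hg, fun i => hεu ((dist_integral_le (m i) f g).trans_lt hfg)⟩
  have := eq_top_of_trig_mem V hV h
  exact (this ▸ Submodule.mem_top : f ∈ V)

/-- A probability measure on the torus is determined by its Fourier coefficients. -/
lemma eq_of_integral_trig_eq {m₀ m₁ : Measure (Torus n)} [IsProbabilityMeasure m₀]
    [IsProbabilityMeasure m₁] (h : ∀ k b, ∫ x, trig k b x ∂m₀ = ∫ x, trig k b x ∂m₁) :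
    m₀ = m₁ := by
  let V : Submodule ℝ C(Torus n, ℝ) :=
    { carrier := {f | ∫ x, f x ∂m₀ = ∫ x, f x ∂m₁}
      add_mem' := fun {f g} hf hg => by
        simp only [mem_ofPred_eq, ContinuousMap.add_apply] at *
        rw [integral_add (integrable_continuousMap _ f) (integrable_continuousMap _ g),
          integral_add (integrable_continuousMap _ f) (integrable_continuousMap _ g), hf, hg]
      zero_mem' := by simp
      smul_mem' := fun c f hf => by
        simp only [mem_ofPred_eq, ContinuousMap.smul_apply, smul_eq_mul, integral_const_mul] at *
        rw [hf] }
  have hc : ∀ (m : Measure (Torus n)) [IsProbabilityMeasure m],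
      Continuous fun f : C(Torus n, ℝ) => ∫ x, f x ∂m := fun m _ =>
    (LipschitzWith.of_dist_le_mul (K := 1) fun f g => by
      simpa using dist_integral_le m f g).continuous
  have hV : V = ⊤ := eq_top_of_trig_mem V (isClosed_eq (hc m₀) (hc m₁)) h
  refine ext_of_forall_integral_eq_of_IsFiniteMeasure fun f => ?_
  exact (hV ▸ Submodule.mem_top : f.toContinuousMap ∈ V)

lemma const_mem_C1Lip (hT : 0 < T) {f : Torus n → ℝ}
    (hf : ContDiff ℝ 1 fun y : Vel n => f (proj y)) : (fun _ x => f x) ∈ C1Lip n T :=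
  have h : ContDiff ℝ 1 (lift fun (_ : ℝ) x => f x) := hf.comp contDiff_snd
  ⟨h.contDiffOn, exists_lipschitzOnWith_lift hT h.contDiffOn⟩

/-- Closed sets form a generating π-system, and the mass of a closed set is a limit of integrals of
continuous functions, each continuous in `t`. This makes a weakly continuous curve a kernel. -/
lemma measurable_of_continuous_probabilityMeasure {m : ℝ → ProbabilityMeasure (Torus n)}
    (hm : Continuous m) : Measurable fun t => (m t : Measure (Torus n)) := by
  refine Measurable.measure_of_isPiSystem_of_isProbabilityMeasure
    (S := {s | IsClosed s}) ?_ isPiSystem_isClosed fun s hs => ?_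
  · rw [BorelSpace.measurable_eq (α := Torus n), borel_eq_generateFrom_isClosed]
  · have hs : IsClosed s := hs
    refine measurable_of_tendsto_metrizable (f := fun N t => ∫⁻ x, hs.apprSeq N x ∂(m t))
      (fun N => ?_) (tendsto_pi_nhds.2 fun t => HasOuterApproxClosed.tendsto_lintegral_apprSeq hs _)
    exact ((ProbabilityMeasure.continuous_iff_forall_continuous_lintegral.1 hm) _).measurable

variable {μ : Measure (ℝ × Torus n)}

/-- An orbit of finite energy has a weakly continuous version. -/
lemma exists_continuous_version (hT : 0 < T) (hμ : μ ∈ H n T 2) :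
    ∃ κ : Kernel ℝ (Torus n), Decomposes T μ κ ∧
      ∀ f : C(Torus n, ℝ), ContinuousOn (fun t => ∫ x, f x ∂(κ t)) (Icc 0 T) := by
  obtain ⟨⟨κ, hκ⟩, ν, hν, hv⟩ := hμ
  have hmk := hκ.1
  have hO : μ ∈ Orbits n T := ⟨κ, hκ⟩
  have hmem : ∀ k b, (fun (_ : ℝ) x => trig k b x) ∈ C1Lip n T := fun k b =>
    const_mem_C1Lip hT (contDiff_trig k b)
  choose c hc using fun k b => exists_timeMean_ae_eq hT hκ hν hv (hmem k b)
  let g : (Fin n → ℤ) → Bool → ℝ → ℝ := fun k b t =>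
    transportUpTo ν (fun _ x => trig k b x) t + c k b
  have hg : ∀ k b, Continuous (g k b) := fun k b =>
    (continuous_transportUpTo hO hν.1 hv (hmem k b)).add continuous_const
  -- The monomials are countable, so a single null set of times serves them all; `D` has full
  -- measure and is therefore dense in `[0,T]`.
  let D : Set ℝ := {t | t ∈ Icc 0 T ∧ ∀ k b, ∫ x, trig k b x ∂(κ t) = g k b t}
  have hD : ∀ᵐ t ∂(volume.restrict (Icc 0 T)), t ∈ D := by
    have h1 : ∀ᵐ t ∂(volume.restrict (Icc 0 T)), ∀ k b, ∫ x, trig k b x ∂(κ t) = g k b t := by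
      simp_rw [ae_all_iff]
      exact hc
    filter_upwards [h1, ae_restrict_mem measurableSet_Icc] with t ht ht' using ⟨ht', ht⟩
  have hdense : Icc 0 T ⊆ closure D := by
    rw [← closure_Ioo hT.ne]
    refine closure_minimal (fun t ht => ?_) isClosed_closure
    rw [mem_closure_iff]
    intro o ho hto
    have h1 : (o ∩ Ioo 0 T).Nonempty := ⟨t, hto, ht⟩
    have h2 := (ho.inter isOpen_Ioo).measure_pos volume h1
    by_contra hne
    refine h2.ne' ?_
    rw [ae_restrict_iff' measurableSet_Icc, ae_iff] at hD
    refine measure_mono_null (fun s hs => ?_) hD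
    exact fun h => hne ⟨s, hs.1, h (Ioo_subset_Icc_self hs.2)⟩
  -- At every time, including those outside `D`, a limit point of `κ s` as `s → t` in `D` has the
  -- coefficients `g k b t`, by continuity of `g`.
  have hlim : ∀ t : Icc 0 T, ∃ m : ProbabilityMeasure (Torus n),
      ∀ k b, ∫ x, trig k b x ∂(m : Measure (Torus n)) = g k b t := by
    intro t
    have : (𝓝[D] (t : ℝ)).NeBot := mem_closure_iff_nhdsWithin_neBot.1 (hdense t.2)
    let U := Ultrafilter.of (𝓝[D] (t : ℝ))
    have hU : (U : Filter ℝ) ≤ 𝓝[D] (t : ℝ) := Ultrafilter.of_le _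
    let P : ℝ → ProbabilityMeasure (Torus n) := fun s => ⟨κ s, inferInstance⟩
    obtain ⟨m, -, hm⟩ := isCompact_univ.ultrafilter_le_nhds (U.map P) (by simp)
    refine ⟨m, fun k b => ?_⟩
    have h1 : Tendsto P U (𝓝 m) := hm
    have h2 := (ProbabilityMeasure.tendsto_iff_forall_integral_tendsto.1 h1)
      (BoundedContinuousFunction.mkOfCompact (trig k b))
    have h3 : Tendsto (g k b) U (𝓝 (g k b t)) :=
      (hg k b).continuousAt.tendsto.mono_left (hU.trans nhdsWithin_le_nhds)
    refine tendsto_nhds_unique h2 (h3.congr' ?_)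
    filter_upwards [hU self_mem_nhdsWithin] with s hs
    exact (hs.2 k b).symm
  choose m hm using hlim
  -- Constant extension beyond the end times keeps the curve continuous on all of `ℝ`, as the
  -- measurability of the kernel requires.
  let m' : ℝ → ProbabilityMeasure (Torus n) := fun t => m (projIcc 0 T hT.le t)
  have hmc : ∀ f : C(Torus n, ℝ), Continuous fun t => ∫ x, f x ∂(m' t : Measure (Torus n)) := by
    refine continuous_integral_of_trig fun k b => ?_
    simp only [m', hm]
    exact (hg k b).comp (continuous_subtype_val.comp continuous_projIcc)
  have hm'c : Continuous m' :=
    ProbabilityMeasure.continuous_iff_forall_continuous_integral.2 fun f => hmc f.toContinuousMap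
  let κ' : Kernel ℝ (Torus n) :=
    ⟨fun t => (m' t : Measure (Torus n)), measurable_of_continuous_probabilityMeasure hm'c⟩
  have hκ' : IsMarkovKernel κ' := ⟨fun t => (m' t).2⟩
  refine ⟨κ', ⟨hκ', ?_⟩, fun f => (hmc f).continuousOn⟩
  rw [hκ.2]
  refine Measure.compProd_congr ?_
  filter_upwards [hD] with t ht
  refine eq_of_integral_trig_eq fun k b => ?_
  rw [ht.2 k b]
  change _ = ∫ x, trig k b x ∂(m (projIcc 0 T hT.le t) : Measure (Torus n))
  rw [hm, projIcc_of_mem hT.le ht.1]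

end

/-! ### Riesz representation and the dual formulas for the norm. -/

section

variable {n : ℕ} {T : ℝ}

/-- A linear functional dominated by the norm of a linear map into a Hilbert space is the inner
product with a vector. -/
lemma exists_inner_eq_of_abs_le {P E : Type*} [AddCommGroup P] [Module ℝ P]
    [NormedAddCommGroup E] [InnerProductSpace ℝ E] [CompleteSpace E] (G : P →ₗ[ℝ] E)
    (l : P →ₗ[ℝ] ℝ) {M : ℝ} (hM : 0 ≤ M) (h : ∀ p, |l p| ≤ M * ‖G p‖) :
    ∃ w : E, ‖w‖ ≤ M ∧ ∀ p, inner ℝ w (G p) = l p := by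
  -- The bound forces `l` to vanish where `G` does, so `l` descends to a bounded functional on the
  -- range of `G`; Hahn-Banach extends it without increasing the norm, and Riesz represents it.
  have hker : LinearMap.ker G ≤ LinearMap.ker l := fun p hp => by
    have h1 := h p
    rw [LinearMap.mem_ker.1 hp, norm_zero, mul_zero] at h1
    exact abs_nonpos_iff.1 h1
  let l' : LinearMap.range G →ₗ[ℝ] ℝ :=
    ((LinearMap.ker G).liftQ l hker) ∘ₗ G.quotKerEquivRange.symm.toLinearMap
  have hl' : ∀ p, l' ⟨G p, LinearMap.mem_range_self G p⟩ = l p := fun p => by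
    have := G.quotKerEquivRange_symm_apply_image p (LinearMap.mem_range_self G p)
    simp [l', this]
  have hb : ∀ z : LinearMap.range G, ‖l' z‖ ≤ M * ‖z‖ := by
    rintro ⟨_, p, rfl⟩
    rw [hl']
    exact h p
  obtain ⟨g, hg, hgn⟩ := exists_extension_norm_eq (LinearMap.range G) (l'.mkContinuous M hb)
  refine ⟨(InnerProductSpace.toDual ℝ E).symm g, ?_, fun p => ?_⟩
  · rw [LinearIsometryEquiv.norm_map, hgn]
    exact l'.mkContinuous_norm_le hM hb
  · rw [InnerProductSpace.toDual_symm_apply, ← hl']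
    exact hg ⟨G p, LinearMap.mem_range_self G p⟩

variable {μ : Measure (ℝ × Torus n)}

lemma ae_spaceGrad_add (h : μ ∈ Orbits n T) {φ ψ : ℝ → Torus n → ℝ} (hφ : φ ∈ C10 n T)
    (hψ : ψ ∈ C10 n T) : (fun q : ℝ × Torus n => spaceGrad (φ + ψ) q.1 q.2) =ᵐ[μ]
      (fun q => spaceGrad φ q.1 q.2) + fun q => spaceGrad ψ q.1 q.2 := by
  filter_upwards [ae_mem_Ioo h] with q hq
  exact spaceGrad_add (contDiffOn_lift_of_C10 hφ) (contDiffOn_lift_of_C10 hψ) hq q.2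

lemma ae_spaceGrad_smul (h : μ ∈ Orbits n T) (c : ℝ) {φ : ℝ → Torus n → ℝ} (hφ : φ ∈ C10 n T) :
    (fun q : ℝ × Torus n => spaceGrad (c • φ) q.1 q.2) =ᵐ[μ]
      c • fun q : ℝ × Torus n => spaceGrad φ q.1 q.2 := by
  filter_upwards [ae_mem_Ioo h] with q hq
  exact spaceGrad_smul c (contDiffOn_lift_of_C10 hφ) hq q.2

lemma ae_timeDeriv_smul (h : μ ∈ Orbits n T) (c : ℝ) {φ : ℝ → Torus n → ℝ} (hφ : φ ∈ C10 n T) :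
    (fun q : ℝ × Torus n => timeDeriv (c • φ) q.1 q.2) =ᵐ[μ] fun q => c * timeDeriv φ q.1 q.2 := by
  filter_upwards [ae_mem_Ioo h] with q hq
  exact timeDeriv_smul c (contDiffOn_lift_of_C10 hφ) hq q.2

/-- The gradient as a linear map from `C¹₀` to `L²(μ)`. -/
noncomputable def gradLp (hT : 0 < T) (h : μ ∈ Orbits n T) :
    C10Submodule n T →ₗ[ℝ] Lp (Vel n) 2 μ where
  toFun φ := (memLp_spaceGrad h (C10_subset_C1Lip hT φ.2) 2).toLp _
  map_add' φ ψ := by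
    rw [← MemLp.toLp_add]
    exact MemLp.toLp_congr _ _ (ae_spaceGrad_add h φ.2 ψ.2)
  map_smul' c φ := by
    rw [RingHom.id_apply, ← MemLp.toLp_const_smul]
    exact MemLp.toLp_congr _ _ (ae_spaceGrad_smul h c φ.2)

/-- The functional `φ ↦ -∫ φ_t dμ` on `C¹₀`. -/
noncomputable def negTimeDeriv (hT : 0 < T) (h : μ ∈ Orbits n T) : C10Submodule n T →ₗ[ℝ] ℝ where
  toFun φ := -∫ q, timeDeriv φ.1 q.1 q.2 ∂μ
  map_add' φ ψ := by
    rw [← neg_add, ← integral_add (integrable_timeDeriv h (C10_subset_C1Lip hT φ.2))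
      (integrable_timeDeriv h (C10_subset_C1Lip hT ψ.2))]
    refine congrArg _ (integral_congr_ae ?_)
    filter_upwards [ae_mem_Ioo h] with q hq
    exact timeDeriv_add (contDiffOn_lift_of_C10 φ.2) (contDiffOn_lift_of_C10 ψ.2) hq q.2
  map_smul' c φ := by
    rw [RingHom.id_apply, smul_eq_mul, mul_neg, ← integral_const_mul]
    exact congrArg _ (integral_congr_ae (ae_timeDeriv_smul h c φ.2))

lemma norm_sq_gradLp (hT : 0 < T) (h : μ ∈ Orbits n T) (φ : C10Submodule n T) :
    ‖gradLp hT h φ‖ ^ 2 = ∫ q, ‖spaceGrad φ.1 q.1 q.2‖ ^ 2 ∂μ := by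
  rw [← real_inner_self_eq_norm_sq, L2.inner_def]
  refine integral_congr_ae ?_
  filter_upwards [(memLp_spaceGrad h (C10_subset_C1Lip hT φ.2) 2).coeFn_toLp] with q hq
  rw [real_inner_self_eq_norm_sq]
  change ‖(MemLp.toLp _ (memLp_spaceGrad h (C10_subset_C1Lip hT φ.2) 2) : ℝ × Torus n → Vel n) q‖ ^ 2
    = _
  rw [hq]

lemma lintegral_enorm_sq_Lp (w : Lp (Vel n) 2 μ) :
    ∫⁻ q, ‖w q‖ₑ ^ (2 : ℝ) ∂μ = ENNReal.ofReal (‖w‖ ^ 2) := by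
  rw [← real_inner_self_eq_norm_sq, L2.inner_def, ofReal_integral_eq_lintegral_ofReal
    (L2.integrable_inner w w) (Eventually.of_forall fun q => real_inner_self_nonneg)]
  refine lintegral_congr fun q => ?_
  rw [real_inner_self_eq_norm_sq, ← ofReal_norm,
    ENNReal.ofReal_rpow_of_nonneg (norm_nonneg _) zero_le_two]
  simp

/-- A bound on the quotients yields a lifting, carried by a vector field, with the same bound. -/
lemma exists_lifting_of_quotient_le (hT : 0 < T) (h : μ ∈ Orbits n T) {Q : ℝ≥0∞} (hQ : Q ≠ ∞)
    (hq : ∀ φ ∈ C10 n T, quotient μ φ ≤ Q) :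
    ∃ ν, IsLifting T μ ν ∧ ∫⁻ q, ‖q.2‖ₑ ^ (2 : ℝ) ∂ν ≤ Q := by
  -- Since `a / 0 = ∞` for `a > 0` and `Q` is finite, the quotient bound also forces `∫ φ_t dμ = 0`
  -- when the gradient vanishes, so `|∫ φ_t dμ| ≤ √Q ‖∇φ‖` in all cases.
  obtain ⟨w, hwn, hw⟩ := exists_inner_eq_of_abs_le (gradLp hT h) (negTimeDeriv hT h)
    (Real.sqrt_nonneg Q.toReal) (fun φ => by
      have h1 := hq φ.1 φ.2
      rw [quotient, ENNReal.div_le_iff_le_mul (Or.inr hQ) (Or.inl ENNReal.ofReal_ne_top),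
        ← norm_sq_gradLp hT h φ, ← ENNReal.ofReal_toReal hQ,
        ← ENNReal.ofReal_mul ENNReal.toReal_nonneg, ENNReal.ofReal_le_ofReal_iff (by positivity)]
        at h1
      refine abs_le_of_sq_le_sq ?_ (by positivity)
      rw [mul_pow, Real.sq_sqrt ENNReal.toReal_nonneg]
      refine le_trans (le_of_eq ?_) h1
      simp [negTimeDeriv])
  have hwm : StronglyMeasurable w := Lp.stronglyMeasurable w
  have hm : Measurable fun q : ℝ × Torus n => (q, w q) := measurable_id.prodMk hwm.measurable
  refine ⟨μ.map fun q => (q, w q), ⟨?_, fun φ hφ => ?_⟩, ?_⟩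
  · rw [Measure.map_map measurable_fst hm]
    exact Measure.map_id
  · have hL := C10_subset_C1Lip hT hφ
    have hco := (memLp_spaceGrad h hL 2).coeFn_toLp
    have hI : Integrable (fun q : ℝ × Torus n => inner ℝ (w q) (spaceGrad φ q.1 q.2)) μ := by
      refine (L2.integrable_inner (𝕜 := ℝ) w (gradLp hT h ⟨φ, hφ⟩)).congr ?_
      filter_upwards [hco] with q hq
      exact congrArg _ hq
    have hM : AEStronglyMeasurable (fun q : (ℝ × Torus n) × Vel n =>
        timeDeriv φ q.1.1 q.1.2 + inner ℝ q.2 (spaceGrad φ q.1.1 q.1.2))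
        (μ.map fun q => (q, w q)) := by
      have hp : MeasurePreserving Prod.fst (μ.map fun q => (q, w q)) μ :=
        ⟨measurable_fst, by rw [Measure.map_map measurable_fst hm]; exact Measure.map_id⟩
      exact ((integrable_timeDeriv h hL).aestronglyMeasurable.comp_measurePreserving hp).add
        (measurable_snd.aestronglyMeasurable.inner
          ((memLp_spaceGrad h hL 2).aestronglyMeasurable.comp_measurePreserving hp))
    rw [integrable_map_measure hM hm.aemeasurable, integral_map hm.aemeasurable hM]
    refine ⟨(integrable_timeDeriv h hL).add hI, ?_⟩
    rw [integral_add (integrable_timeDeriv h hL) hI]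
    have h2 := hw ⟨φ, hφ⟩
    rw [L2.inner_def] at h2
    have h3 : ∫ q, inner ℝ (w q) (spaceGrad φ q.1 q.2) ∂μ = -∫ q, timeDeriv φ q.1 q.2 ∂μ := by
      refine Eq.trans (integral_congr_ae ?_) h2
      filter_upwards [hco] with q hq
      exact congrArg _ hq.symm
    rw [h3, add_neg_cancel]
  · rw [lintegral_map (measurable_snd.enorm.pow_const _) hm, lintegral_enorm_sq_Lp]
    refine ENNReal.ofReal_le_of_le_toReal ?_
    rw [← Real.sq_sqrt (ENNReal.toReal_nonneg (a := Q))]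
    exact pow_le_pow_left₀ (norm_nonneg _) hwn 2

lemma hNorm_sq_le {ν : Measure ((ℝ × Torus n) × Vel n)} (hν : IsLifting T μ ν) :
    hNorm T 2 μ ^ 2 ≤ ∫⁻ q, ‖q.2‖ₑ ^ (2 : ℝ) ∂ν := by
  have h1 : hNorm T 2 μ ≤ (∫⁻ q, ‖q.2‖ₑ ^ (2 : ℝ) ∂ν) ^ (1 / 2 : ℝ) := iInf₂_le ν hν
  refine (pow_le_pow_left₀ zero_le h1 2).trans_eq ?_
  rw [← ENNReal.rpow_natCast, ← ENNReal.rpow_mul]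
  simp

lemma le_hNorm_sq {a : ℝ≥0∞}
    (h : ∀ ν, IsLifting T μ ν → a ≤ ∫⁻ q, ‖q.2‖ₑ ^ (2 : ℝ) ∂ν) : a ≤ hNorm T 2 μ ^ 2 := by
  have h1 : a ^ (1 / 2 : ℝ) ≤ hNorm T 2 μ :=
    le_iInf₂ fun ν hν => ENNReal.rpow_le_rpow (h ν hν) (by norm_num)
  refine le_trans (le_of_eq ?_) (pow_le_pow_left₀ zero_le h1 2)
  rw [← ENNReal.rpow_natCast, ← ENNReal.rpow_mul]
  simp

/-- Liftings of infinite energy impose nothing on the infimum, so real-valued estimates, available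
only for finite energy, suffice. -/
lemma coe_le_half_hNorm_sq {a : ℝ} (h : ∀ ν, IsLifting T μ ν →
    ∫⁻ q, ‖q.2‖ₑ ^ (2 : ℝ) ∂ν < ∞ → a ≤ (∫⁻ q, ‖q.2‖ₑ ^ (2 : ℝ) ∂ν).toReal / 2) :
    (a : EReal) ≤ ((1 / 2 : ℝ≥0∞) * hNorm T 2 μ ^ 2 : ℝ≥0∞) := by
  have h1 : ENNReal.ofReal (2 * a) ≤ hNorm T 2 μ ^ 2 := by
    refine le_hNorm_sq fun ν hν => ?_
    rcases eq_or_ne (∫⁻ q, ‖q.2‖ₑ ^ (2 : ℝ) ∂ν) ∞ with h2 | h2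
    · exact h2 ▸ le_top
    · refine ENNReal.ofReal_le_of_le_toReal ?_
      linarith [h ν hν h2.lt_top]
  have h2 : ENNReal.ofReal a ≤ (1 / 2 : ℝ≥0∞) * hNorm T 2 μ ^ 2 := by
    refine le_trans (le_of_eq ?_) (mul_le_mul_right h1 _)
    rw [ENNReal.ofReal_mul zero_le_two, ← mul_assoc]
    simp [ENNReal.inv_mul_cancel]
  refine le_trans ?_ (EReal.coe_ennreal_le_coe_ennreal_iff.2 h2)
  rw [EReal.coe_ennreal_ofReal]
  exact_mod_cast le_max_left a 0

lemma hjIntegral_smul (hT : 0 < T) (h : μ ∈ Orbits n T) (c : ℝ) {φ : ℝ → Torus n → ℝ}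
    (hφ : φ ∈ C10 n T) : hjIntegral μ (c • φ) = c * ∫ q, timeDeriv φ q.1 q.2 ∂μ +
      c ^ 2 * (∫ q, ‖spaceGrad φ q.1 q.2‖ ^ 2 ∂μ) / 2 := by
  have hc : c • φ ∈ C10 n T := (C10Submodule n T).smul_mem c hφ
  rw [hjIntegral_eq h (C10_subset_C1Lip hT hc), integral_congr_ae (ae_timeDeriv_smul h c hφ),
    integral_const_mul, ← integral_const_mul (c ^ 2)]
  congr 2
  refine integral_congr_ae ?_
  filter_upwards [ae_spaceGrad_smul h c hφ] with q hq
  simp only [hq, Pi.smul_apply, norm_smul, mul_pow, Real.norm_eq_abs, sq_abs]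

/-- With `a = ∫ φ_t dμ` and `b = ∫ |∇φ|² dμ`, the hypothesis for `cφ` reads `c² b/2 + c a + s ≥ 0`
for all real `c`. Its discriminant is nonpositive: `a² ≤ 2 s b`. -/
lemma quotient_le_of_neg_hjIntegral_le (hT : 0 < T) (h : μ ∈ Orbits n T) {s : ℝ}
    (hs : ∀ φ ∈ C10 n T, -hjIntegral μ φ ≤ s) {φ : ℝ → Torus n → ℝ} (hφ : φ ∈ C10 n T) :
    quotient μ φ ≤ ENNReal.ofReal (2 * s) := by
  have hb : 0 ≤ ∫ q, ‖spaceGrad φ q.1 q.2‖ ^ 2 ∂μ := integral_nonneg fun q => by positivity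
  have h1 := discrim_le_zero (a := (∫ q, ‖spaceGrad φ q.1 q.2‖ ^ 2 ∂μ) / 2)
    (b := ∫ q, timeDeriv φ q.1 q.2 ∂μ) (c := s) fun c => by
      have h2 := hs _ ((C10Submodule n T).smul_mem c hφ)
      rw [hjIntegral_smul hT h c hφ] at h2
      nlinarith
  have h0 : 0 ≤ s := by
    have h2 := hs _ ((C10Submodule n T).smul_mem 0 hφ)
    rw [hjIntegral_smul hT h 0 hφ] at h2
    simpa using h2
  rw [quotient, ENNReal.div_le_iff_le_mul (Or.inr ENNReal.ofReal_ne_top)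
    (Or.inl ENNReal.ofReal_ne_top), ← ENNReal.ofReal_mul (by positivity)]
  refine ENNReal.ofReal_le_ofReal ?_
  rw [discrim] at h1
  linarith

lemma hNorm_sq_ne_top (hμ : μ ∈ H n T 2) : hNorm T 2 μ ^ 2 ≠ ∞ := by
  obtain ⟨-, ν, hν, hv⟩ := hμ
  exact ((hNorm_sq_le hν).trans_lt hv).ne

lemma neg_iInf_le_iff {s : Set (ℝ → Torus n → ℝ)} {F : (ℝ → Torus n → ℝ) → ℝ} {a : EReal} :
    -(⨅ φ ∈ s, (F φ : EReal)) ≤ a ↔ ∀ φ ∈ s, ((-F φ : ℝ) : EReal) ≤ a := by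
  rw [EReal.neg_le, le_iInf₂_iff]
  refine forall₂_congr fun φ _ => ?_
  rw [EReal.neg_le, EReal.coe_neg]

lemma neg_hjIntegral_le (hT : 0 < T) (hμ : μ ∈ Orbits n T) {φ : ℝ → Torus n → ℝ}
    (hφ : φ ∈ C10 n T) :
    ((-hjIntegral μ φ : ℝ) : EReal) ≤ ((1 / 2 : ℝ≥0∞) * hNorm T 2 μ ^ 2 : ℝ≥0∞) := by
  refine coe_le_half_hNorm_sq fun ν hν hv => ?_
  have h1 := neg_transport_le hμ hν.1 hv (C10_subset_C1Lip hT hφ)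
  rw [(hν.2 φ hφ).2] at h1
  linarith

/-- The dual formulas for the norm. -/
lemma half_hNorm_sq_eq (hT : 0 < T) (hμ : μ ∈ H n T 2) :
    ((((1 / 2 : ℝ≥0∞) * hNorm T 2 μ ^ 2 : ℝ≥0∞) : EReal) =
        -⨅ φ ∈ C10 n T, ((hjIntegral μ φ : ℝ) : EReal)) ∧
    hNorm T 2 μ ^ 2 = ⨆ φ ∈ C10 n T, quotient μ φ := by
  have hO := hμ.1
  set N := hNorm T 2 μ ^ 2 with hN
  set X : EReal := -⨅ φ ∈ C10 n T, ((hjIntegral μ φ : ℝ) : EReal) with hX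
  have hNt : N ≠ ∞ := hNorm_sq_ne_top hμ
  have h1 : X ≤ ((1 / 2 : ℝ≥0∞) * N : ℝ≥0∞) :=
    neg_iInf_le_iff.2 fun φ hφ => neg_hjIntegral_le hT hO hφ
  have hle : ∀ φ ∈ C10 n T, ((-hjIntegral μ φ : ℝ) : EReal) ≤ X := neg_iInf_le_iff.1 le_rfl
  have hz : (0 : ℝ → Torus n → ℝ) ∈ C10 n T := (C10Submodule n T).zero_mem
  have hXt : X ≠ ⊤ := fun h => by
    rw [h, top_le_iff, EReal.coe_ennreal_eq_top_iff] at h1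
    exact ENNReal.mul_ne_top (by simp) hNt h1
  have hXb : X ≠ ⊥ := fun h => by
    have := hle 0 hz
    rw [h, le_bot_iff] at this
    exact EReal.coe_ne_bot _ this
  lift X to ℝ using ⟨hXt, hXb⟩ with s
  have hs : ∀ φ ∈ C10 n T, -hjIntegral μ φ ≤ s := fun φ hφ => EReal.coe_le_coe_iff.1 (hle φ hφ)
  have hs0 : 0 ≤ s := by
    have h2 := hs _ ((C10Submodule n T).smul_mem 0 hz)
    rw [hjIntegral_smul hT hO 0 hz] at h2
    simpa using h2
  -- From here the cycle `N ≤ sup quotient ≤ 2s ≤ N` is assembled; the last inequality is `h1`.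
  have hQ : ∀ φ ∈ C10 n T, quotient μ φ ≤ ENNReal.ofReal (2 * s) := fun φ hφ =>
    quotient_le_of_neg_hjIntegral_le hT hO hs hφ
  have h2s : (1 / 2 : ℝ≥0∞) * ENNReal.ofReal (2 * s) = ENNReal.ofReal s := by
    rw [ENNReal.ofReal_mul zero_le_two, ← mul_assoc]
    simp [ENNReal.inv_mul_cancel]
  have hS : ⨆ φ ∈ C10 n T, quotient μ φ ≤ ENNReal.ofReal (2 * s) := iSup₂_le hQ
  have hNS : N ≤ ⨆ φ ∈ C10 n T, quotient μ φ := by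
    obtain ⟨ν, hν, hle⟩ := exists_lifting_of_quotient_le hT hO
      (ne_top_of_le_ne_top ENNReal.ofReal_ne_top hS) fun φ hφ =>
        le_iSup₂ (f := fun φ (_ : φ ∈ C10 n T) => quotient μ φ) φ hφ
    exact (hNorm_sq_le hν).trans hle
  have hsN : ENNReal.ofReal s ≤ (1 / 2 : ℝ≥0∞) * N := by
    rw [← EReal.coe_ennreal_le_coe_ennreal_iff, EReal.coe_ennreal_ofReal, max_eq_left hs0]
    exact h1
  have hNs : N ≤ ENNReal.ofReal (2 * s) := hNS.trans hS
  have heq : (1 / 2 : ℝ≥0∞) * N = ENNReal.ofReal s :=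
    le_antisymm ((mul_le_mul_right hNs _).trans_eq h2s) hsN
  refine ⟨?_, le_antisymm hNS (hS.trans ?_)⟩
  · rw [heq, EReal.coe_ennreal_ofReal, max_eq_left hs0]
  · rw [← h2s] at hsN
    rwa [ENNReal.mul_le_mul_iff_right (by simp) (by simp)] at hsN

end

/-! ### Prescribed boundary values. -/

section

variable {n : ℕ} {T : ℝ} {μ : Measure (ℝ × Torus n)} {ν : Measure ((ℝ × Torus n) × Vel n)}
  {κ : Kernel ℝ (Torus n)}

lemma pow_mul_mem_C1Lip (hT : 0 < T) {e : ℝ → ℝ} (he : ContDiff ℝ 1 e) (N : ℕ) {f : Torus n → ℝ}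
    (hf : ContDiff ℝ 1 fun y : Vel n => f (proj y)) :
    (fun t x => e t ^ N * f x) ∈ C1Lip n T :=
  have h : ContDiff ℝ 1 (lift fun t x => e t ^ N * f x) :=
    ((he.comp contDiff_fst).pow N).mul (hf.comp contDiff_snd)
  ⟨h.contDiffOn, exists_lipschitzOnWith_lift hT h.contDiffOn⟩

/-- The energy defect of test functions that concentrate at the end times is negligible. -/
lemma tendsto_hjIntegral_sub_transport (hT : 0 < T) (h : μ ∈ Orbits n T)
    (hν : ν.map Prod.fst = μ) (hv : ∫⁻ q, ‖q.2‖ₑ ^ (2 : ℝ) ∂ν < ∞) {e : ℝ → ℝ}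
    (he : ContDiff ℝ 1 e) (he01 : ∀ t ∈ Ioo 0 T, 0 ≤ e t ∧ e t < 1) {f : Torus n → ℝ}
    (hf : ContDiff ℝ 1 fun y : Vel n => f (proj y)) :
    Tendsto (fun N : ℕ => hjIntegral μ (fun t x => e t ^ N * f x) -
      ∫ q, (timeDeriv (fun t x => e t ^ N * f x) q.1.1 q.1.2 +
        inner ℝ q.2 (spaceGrad (fun t x => e t ^ N * f x) q.1.1 q.1.2)) ∂ν) atTop (𝓝 0) := by
  have hF := const_mem_C1Lip hT hf
  set F : ℝ → Torus n → ℝ := fun _ x => f x with hFdef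
  have hN : ∀ N : ℕ, (fun t x => e t ^ N * f x) ∈ C1Lip n T := fun N =>
    pow_mul_mem_C1Lip hT he N hf
  -- The time derivatives, which are not small, cancel in the difference. What remains carries
  -- powers of `e t < 1` and tends to zero by dominated convergence.
  have e1 : ∀ N : ℕ, hjIntegral μ (fun t x => e t ^ N * f x) -
      ∫ q, (timeDeriv (fun t x => e t ^ N * f x) q.1.1 q.1.2 +
        inner ℝ q.2 (spaceGrad (fun t x => e t ^ N * f x) q.1.1 q.1.2)) ∂ν =
      ∫ q, ((e q.1.1 ^ N) ^ 2 * (‖spaceGrad F q.1.1 q.1.2‖ ^ 2 / 2) -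
        e q.1.1 ^ N * inner ℝ q.2 (spaceGrad F q.1.1 q.1.2)) ∂ν := fun N => by
    have i1 : Integrable (fun q : ℝ × Torus n => timeDeriv (fun t x => e t ^ N * f x) q.1 q.2 +
        ‖spaceGrad (fun t x => e t ^ N * f x) q.1 q.2‖ ^ 2 / 2) μ :=
      (integrable_timeDeriv h (hN N)).add ((integrable_sq_spaceGrad h (hN N)).div_const 2)
    have i2 : Integrable (fun q : (ℝ × Torus n) × Vel n =>
        timeDeriv (fun t x => e t ^ N * f x) q.1.1 q.1.2 +
        ‖spaceGrad (fun t x => e t ^ N * f x) q.1.1 q.1.2‖ ^ 2 / 2) ν :=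
      (measurePreserving_fst hν).integrable_comp_of_integrable i1
    rw [hjIntegral, ← integral_lifting_eq hν i1.aestronglyMeasurable,
      ← integral_sub i2 (integrable_transport h hν hv (hN N))]
    refine integral_congr_ae ?_
    filter_upwards [ae_lifting_mem_Ioo h hν] with q hq
    have h1 : spaceGrad (fun t x => e t ^ N * f x) q.1.1 q.1.2 =
        (e q.1.1 ^ N) • spaceGrad F q.1.1 q.1.2 := spaceGrad_mul (fun t => e t ^ N) hF.1 hq q.1.2
    rw [h1, norm_smul, inner_smul_right, mul_pow, Real.norm_eq_abs, sq_abs]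
    ring
  simp_rw [e1]
  have iG : Integrable (fun q : (ℝ × Torus n) × Vel n =>
      ‖spaceGrad F q.1.1 q.1.2‖ ^ 2 / 2) ν :=
    (measurePreserving_fst hν).integrable_comp_of_integrable
      ((integrable_sq_spaceGrad h hF).div_const 2)
  have iI := integrable_velocity_inner h hν hv hF
  have hm : ∀ N : ℕ, AEStronglyMeasurable (fun q : (ℝ × Torus n) × Vel n => e q.1.1 ^ N) ν :=
    fun N => ((he.continuous.pow N).comp
      (continuous_fst.comp continuous_fst)).aestronglyMeasurable
  rw [← integral_zero ((ℝ × Torus n) × Vel n) ℝ (μ := ν)]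
  refine tendsto_integral_of_dominated_convergence
    (fun q => ‖spaceGrad F q.1.1 q.1.2‖ ^ 2 / 2 + ‖inner ℝ q.2 (spaceGrad F q.1.1 q.1.2)‖)
    (fun N => (((hm N).pow 2).mul iG.aestronglyMeasurable).sub
      ((hm N).mul iI.aestronglyMeasurable)) (iG.add iI.norm) (fun N => ?_) ?_
  · filter_upwards [ae_lifting_mem_Ioo h hν] with q hq
    obtain ⟨h0, h1⟩ := he01 _ hq
    have hp0 : 0 ≤ e q.1.1 ^ N := pow_nonneg h0 N
    have hp1 : e q.1.1 ^ N ≤ 1 := pow_le_one₀ h0 h1.le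
    refine (norm_sub_le _ _).trans (add_le_add ?_ ?_)
    · rw [Real.norm_of_nonneg (by positivity)]
      exact mul_le_of_le_one_left (by positivity) (pow_le_one₀ hp0 hp1)
    · rw [norm_mul, Real.norm_of_nonneg hp0]
      exact mul_le_of_le_one_left (norm_nonneg _) hp1
  · filter_upwards [ae_lifting_mem_Ioo h hν] with q hq
    obtain ⟨h0, h1⟩ := he01 _ hq
    have hp := tendsto_pow_atTop_nhds_zero_of_lt_one h0 h1
    simpa using ((hp.pow 2).mul_const (‖spaceGrad F q.1.1 q.1.2‖ ^ 2 / 2)).sub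
      (hp.mul_const (inner ℝ q.2 (spaceGrad F q.1.1 q.1.2)))

/-- Test functions concentrated at an end time detect a mismatch of the boundary values. -/
lemma iInf_hjBoundary_eq_bot (hT : 0 < T) (hκ : Decomposes T μ κ)
    (hcont : ∀ f : C(Torus n, ℝ), ContinuousOn (fun t => ∫ x, f x ∂(κ t)) (Icc 0 T))
    (hν : IsLifting T μ ν) (hv : ∫⁻ q, ‖q.2‖ₑ ^ (2 : ℝ) ∂ν < ∞) {μ₀ μ₁ : Measure (Torus n)}
    {e : ℝ → ℝ} (he : ContDiff ℝ 1 e) (he01 : ∀ t ∈ Ioo 0 T, 0 ≤ e t ∧ e t < 1)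
    (he0 : e 0 = 0 ∨ e 0 = 1) (heT : e T = 0 ∨ e T = 1) {f : Torus n → ℝ}
    (hf : ContDiff ℝ 1 fun y : Vel n => f (proj y))
    (hd : e 0 * (∫ x, f x ∂μ₀ - ∫ x, f x ∂(κ 0)) + e T * (∫ x, f x ∂(κ T) - ∫ x, f x ∂μ₁) ≠ 0) :
    ⨅ φ ∈ C1Lip n T, ((hjBoundary T μ μ₀ μ₁ φ : ℝ) : EReal) = ⊥ := by
  rw [EReal.eq_bot_iff_forall_lt]
  intro y
  set d := e 0 * (∫ x, f x ∂μ₀ - ∫ x, f x ∂(κ 0)) + e T * (∫ x, f x ∂(κ T) - ∫ x, f x ∂μ₁)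
    with hddef
  -- The boundary mismatch contributes `c * d = y - 1` and the energy defect is below `1` for large
  -- `N`, so the functional falls below `y`.
  set c := (y - 1) / d with hc
  have hcd : c * d = y - 1 := div_mul_cancel₀ _ hd
  have hcf : ContDiff ℝ 1 fun z : Vel n => c * f (proj z) := contDiff_const.mul hf
  have hlim := tendsto_hjIntegral_sub_transport hT ⟨κ, hκ⟩ hν.1 hv he he01
    (f := fun x => c * f x) hcf
  obtain ⟨N, hN1, hN⟩ := ((eventually_ge_atTop 1).and (hlim.eventually_lt_const one_pos)).exists
  have hmem := pow_mul_mem_C1Lip hT he N (f := fun x => c * f x) hcf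
  have hN0 : N ≠ 0 := Nat.one_le_iff_ne_zero.1 hN1
  -- Needs `N ≠ 0`, since `0 ^ 0 = 1`.
  have hp0 : e 0 ^ N = e 0 := by rcases he0 with h | h <;> simp [h, hN0]
  have hpT : e T ^ N = e T := by rcases heT with h | h <;> simp [h, hN0]
  refine (iInf₂_le _ hmem).trans_lt ?_
  rw [EReal.coe_lt_coe_iff]
  rw [integral_transport_eq hT hκ hcont hν hv hmem] at hN
  simp only [hjBoundary, hp0, hpT, integral_const_mul] at hN ⊢
  have : c * d = e 0 * (c * ∫ x, f x ∂μ₀) - e 0 * (c * ∫ x, f x ∂(κ 0)) +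
      (e T * (c * ∫ x, f x ∂(κ T)) - e T * (c * ∫ x, f x ∂μ₁)) := by
    rw [hddef]; ring
  linarith

lemma exists_trig_integral_ne {m₀ m₁ : Measure (Torus n)} [IsProbabilityMeasure m₀]
    [IsProbabilityMeasure m₁] (h : m₀ ≠ m₁) :
    ∃ k b, ∫ x, trig k b x ∂m₀ ≠ ∫ x, trig k b x ∂m₁ := by
  by_contra! H
  exact h (eq_of_integral_trig_eq H)

/-- One continuous version is enough: it must miss one of the prescribed end values. The profile `t
/ T` sees only the end time `T` and `1 - t / T` only the time `0`, so mismatches at the two ends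
cannot cancel. -/
lemma iInf_hjBoundary_of_notMem_Lam (hT : 0 < T) (hμ : μ ∈ H n T 2) {μ₀ μ₁ : Measure (Torus n)}
    [IsProbabilityMeasure μ₀] [IsProbabilityMeasure μ₁] (hL : μ ∉ Lam T 2 μ₀ μ₁) :
    ⨅ φ ∈ C1Lip n T, ((hjBoundary T μ μ₀ μ₁ φ : ℝ) : EReal) = ⊥ := by
  obtain ⟨κ, hκ, hcont⟩ := exists_continuous_version hT hμ
  obtain ⟨ν, hν, hv⟩ := hμ.2
  have hmk := hκ.1
  by_cases h0 : κ 0 = μ₀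
  · have h1 : κ T ≠ μ₁ := fun h1 => hL ⟨hμ, κ, hκ, hcont, h0, h1⟩
    obtain ⟨k, b, hkb⟩ := exists_trig_integral_ne h1
    refine iInf_hjBoundary_eq_bot hT hκ hcont hν hv (e := fun t => t / T)
      (contDiff_id.div_const T) (fun t ht => ⟨div_nonneg ht.1.le hT.le, (div_lt_one hT).2 ht.2⟩)
      (by simp) (by simp [hT.ne']) (contDiff_trig k b) ?_
    simpa [hT.ne', sub_eq_zero] using hkb
  · obtain ⟨k, b, hkb⟩ := exists_trig_integral_ne h0
    refine iInf_hjBoundary_eq_bot hT hκ hcont hν hv (e := fun t => 1 - t / T)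
      (contDiff_const.sub (contDiff_id.div_const T)) (fun t ht => ?_)
      (by simp) (by simp [hT.ne']) (contDiff_trig k b) ?_
    · have h2 := div_pos ht.1 hT
      have h3 := (div_lt_one hT).2 ht.2
      constructor <;> linarith
    · simpa [hT.ne', sub_eq_zero] using hkb.symm

lemma hjBoundary_of_mem_C10 {μ₀ μ₁ : Measure (Torus n)} {φ : ℝ → Torus n → ℝ}
    (hφ : φ ∈ C10 n T) : hjBoundary T μ μ₀ μ₁ φ = hjIntegral μ φ := by
  simp [hjBoundary, hφ.2.1, hφ.2.2]

/-- The boundary terms are exactly minus the transport term, so Young's inequality bounds the left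
side. Conversely `C10` lies in the larger class and has no boundary terms there. -/
lemma neg_iInf_hjBoundary_of_mem_Lam (hT : 0 < T) {μ₀ μ₁ : Measure (Torus n)}
    (hL : μ ∈ Lam T 2 μ₀ μ₁) :
    -(⨅ φ ∈ C1Lip n T, ((hjBoundary T μ μ₀ μ₁ φ : ℝ) : EReal)) =
      (((1 / 2 : ℝ≥0∞) * hNorm T 2 μ ^ 2 : ℝ≥0∞) : EReal) := by
  obtain ⟨hμ, κ, hκ, hcont, rfl, rfl⟩ := hL
  refine le_antisymm (neg_iInf_le_iff.2 fun φ hφ => coe_le_half_hNorm_sq fun ν hν hv => ?_) ?_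
  · have h1 := neg_transport_le hμ.1 hν.1 hv hφ
    rw [integral_transport_eq hT hκ hcont hν hv hφ] at h1
    simp only [hjBoundary]
    linarith
  · rw [(half_hNorm_sq_eq hT hμ).1, EReal.neg_le_neg_iff]
    refine le_iInf₂ fun φ hφ => (iInf₂_le φ (C10_subset_C1Lip hT hφ)).trans_eq ?_
    rw [hjBoundary_of_mem_C10 hφ]

end

end MeasureOrbit

theorem corollary4p1 (n : ℕ) (T : ℝ) (hT : 0 < T)
    (μ : Measure (ℝ × MeasureOrbit.Torus n)) (hμ : μ ∈ MeasureOrbit.H n T 2) :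
    ((((1 / 2 : ℝ≥0∞) * MeasureOrbit.hNorm T 2 μ ^ 2 : ℝ≥0∞) : EReal) =
        -⨅ φ ∈ MeasureOrbit.C10 n T, ((MeasureOrbit.hjIntegral μ φ : ℝ) : EReal)) ∧
    ((1 / 2 : ℝ≥0∞) * MeasureOrbit.hNorm T 2 μ ^ 2 =
        (1 / 2 : ℝ≥0∞) * ⨆ φ ∈ MeasureOrbit.C10 n T, MeasureOrbit.quotient μ φ) ∧
    ∀ (μ₀ μ₁ : Measure (MeasureOrbit.Torus n)) [IsProbabilityMeasure μ₀] [IsProbabilityMeasure μ₁],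
      (μ ∈ MeasureOrbit.Lam T 2 μ₀ μ₁ →
        -(⨅ φ ∈ MeasureOrbit.C1Lip n T, ((MeasureOrbit.hjBoundary T μ μ₀ μ₁ φ : ℝ) : EReal)) =
          (((1 / 2 : ℝ≥0∞) * MeasureOrbit.hNorm T 2 μ ^ 2 : ℝ≥0∞) : EReal)) ∧
      (μ ∉ MeasureOrbit.Lam T 2 μ₀ μ₁ →
        -(⨅ φ ∈ MeasureOrbit.C1Lip n T, ((MeasureOrbit.hjBoundary T μ μ₀ μ₁ φ : ℝ) : EReal)) =
          ⊤) := by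
  obtain ⟨h1, h2⟩ := MeasureOrbit.half_hNorm_sq_eq hT hμ
  refine ⟨h1, by rw [h2], fun μ₀ μ₁ _ _ => ⟨fun hL => ?_, fun hL => ?_⟩⟩
  · exact MeasureOrbit.neg_iInf_hjBoundary_of_mem_Lam hT hL
  · rw [MeasureOrbit.iInf_hjBoundary_of_notMem_Lam hT hμ hL, EReal.neg_bot]
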